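/- **Setting.** Let $\mathscr T$ be a finite rooted ordered binary tree (every vertex has at most two children) with edge set $E$, $|E|\ge 2$, let $d,n\ge 1$, and let $X=\prod_{e\in E}(\mathbb R^d)^n$. Two points $x,y\in X$ are equivalent, $x\sim y$, if they represent the same ordered tree-shape: there is a bijection from $\{e: x_e\ne 0\}$ to $\{e: y_e\ne 0\}$ that preserves the ancestor relation and the depth-first order of edges (i.e. an isomorphism of the ordered trees obtained by collapsing all edges with zero attribute) and that matches the attributes. Let $\bar X=X/\!\sim$ be the space of ordered tree-shapes. More generally, let $\mathcal F$ be a set of subsets of $E$ that contains, with a subset $S$, every subset $S'$ of the same topology (collapsing the edges outside of $S$, respectively $S'$, gives isomorphic ordered trees). Put $Z=\bigcup_{S\in\mathcal F}\{x\in X: x_e=0\text{ for }e\notin S\}$ and $\bar Z=Z/\!\sim$, the restricted tree-shape space. The choice of all subsets of $E$ gives $Z=X$, $\bar Z=\bar X$. For the metrics $d_1(x,y)=\sum_e\|x_e-y_e\|$ and $d_2(x,y)=\bigl(\sum_e\|x_e-y_e\|^2\bigr)^{1/2}$ on $X$, let $\bar d_i$ be the quotient metric on $\bar Z$: $\bar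 d_i(\bar x,\bar y)$ is the infimum of $\sum_{j=1}^k d_i(x_j,y_j)$ over all $k\ge1$ and all segments $[x_j,y_j]\subseteq Z$ with $x_1\in\bar x$, $y_j\sim x_{j+1}$, $y_k\in\bar y$. The metric $\bar d_1$ is called TED and $\bar d_2$ is called QED. A metric space is locally $CAT(\kappa)$ at a point $x$ if some ball $B(x,r)$, $r>0$, with the induced metric is a $CAT(\kappa)$ space. The curvature at $x$ is $+\infty$ if the space is not locally $CAT(\kappa)$ at $x$ for any $\kappa\in\mathbb R$. A set of points is generic if it is open and dense. **Theorem.** (i) There is an open dense set $G\subseteq(\bar X,\bar d_2)$ such that every $\bar x\in G$ has a neighbourhood in which the curvature is non-positive (i.e. the space is locally $CAT(0)$ at each point of the neighbourhood), while the curvature is $+\infty$ at every point $\bar x\notin G$. (ii) In $(\bar X,\bar d_1)$ geodesics are nowhere locally unique: every neighbourhood $U$ of every point contains two points that are joined by two different geodesics inside $U$. The curvature of $(\bar X,\bar d_1)$ is $+\infty$ at every point. (iii) Statement (i) also holds for every restricted tree-shape space $(\bar Z,\bar d_2)$. Statement (ii) also holds for every restricted tree-shape space $(\bar Z,\bar d_1)$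 for which each topology in $\mathcal F$ is, or arises by collapsing edges from, a topology in $\mathcal F$ with at least two edges. -/

import Mathlib

open Set Filter Topology
open scoped ENNReal

set_option linter.unusedSectionVars false

noncomputable section

namespace TreeShape

/-! ### Geodesics and upper curvature bounds in metric spaces -/

section Curvature

/-- `γ`, restricted to `[0, dist a b]`, is a geodesic from `a` to `b`. -/
def IsGeodesic {Y : Type*} [MetricSpace Y] (γ : ℝ → Y) (a b : Y) : Prop :=
  γ 0 = a ∧ γ (dist a b) = b ∧
    ∀ t ∈ Icc 0 (dist a b), ∀ t' ∈ Icc 0 (dist a b), dist (γ t) (γ t') = |t - t'|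

/-- The geodesic `γ` from `a` to `b` runs inside `s`. -/
def IsGeodesicIn {Y : Type*} [MetricSpace Y] (s : Set Y) (γ : ℝ → Y) (a b : Y) : Prop :=
  IsGeodesic γ a b ∧ ∀ t ∈ Icc 0 (dist a b), γ t ∈ s

/-- Comparison inequality for a triangle with vertices `a`, `b`, `c` and side `γ` from `b` to `c`,
with respect to a model plane `M` with distance function `δ`: there is a comparison triangle
`A, B, C` in `M`, and for every point `γ t` of the side, the comparison point `P` on `BC` satisfies
`dist a (γ t) ≤ δ A P`. -/
def ThinnerThan {Y : Type*} [MetricSpace Y] (M : Type) (δ : M → M → ℝ)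
    (a b c : Y) (γ : ℝ → Y) : Prop :=
  ∃ A B C : M, δ A B = dist a b ∧ δ A C = dist a c ∧ δ B C = dist b c ∧
    ∀ t ∈ Icc 0 (dist b c), ∃ P : M, δ B P = t ∧ δ P C = dist b c - t ∧ dist a (γ t) ≤ δ A P

/-- Comparison with the model plane of constant curvature `κ`: the unit sphere of `ℝ³` with the
angular distance divided by `√κ` for `0 < κ`, the Euclidean plane for `κ = 0`, and the hyperbolic
plane (upper half-plane) with its distance divided by `√(-κ)` for `κ < 0`. -/
def ComparisonInequality {Y : Type*} [MetricSpace Y] (κ : ℝ) (a b c : Y) (γ : ℝ → Y) : Prop :=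
  (0 < κ → ThinnerThan (Metric.sphere (0 : EuclideanSpace ℝ (Fin 3)) 1)
    (fun u v => InnerProductGeometry.angle (u : EuclideanSpace ℝ (Fin 3)) v / √κ) a b c γ) ∧
  (κ = 0 → ThinnerThan (EuclideanSpace ℝ (Fin 2)) (fun u v => dist u v) a b c γ) ∧
  (κ < 0 → ThinnerThan UpperHalfPlane (fun u v => dist u v / √(-κ)) a b c γ)

/-- The subset `s`, with the induced metric, is a `CAT(κ)` space: any two of its points (at
distance less than `π / √κ` if `0 < κ`) are joined by a geodesic in `s`, and every geodesic triangle
in `s` (of perimeter less than `2π / √κ` if `0 < κ`) is at least as thin as its comparison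
triangle. -/
def IsCAT {Y : Type*} [MetricSpace Y] (κ : ℝ) (s : Set Y) : Prop :=
  (∀ a ∈ s, ∀ b ∈ s, (0 < κ → dist a b < Real.pi / √κ) → ∃ γ, IsGeodesicIn s γ a b) ∧
  ∀ a ∈ s, ∀ b ∈ s, ∀ c ∈ s, ∀ γ, IsGeodesicIn s γ b c →
    (0 < κ → dist a b + dist b c + dist c a < 2 * Real.pi / √κ) → ComparisonInequality κ a b c γ

/-- The space is locally `CAT(κ)` at `x`: some ball around `x` is a `CAT(κ)` space. -/
def CurvatureAtMost {Y : Type*} [MetricSpace Y] (κ : ℝ) (x : Y) : Prop :=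
  ∃ r > 0, IsCAT κ (Metric.ball x r)

/-- The curvature at `x` is `+∞`: it is not bounded from above by any real number. -/
def CurvatureInfinite {Y : Type*} [MetricSpace Y] (x : Y) : Prop :=
  ∀ κ : ℝ, ¬ CurvatureAtMost κ x

/-- Local uniqueness of geodesics fails at `x`: every neighbourhood `U` of `x` contains two points
that are joined by two different geodesics inside `U`. -/
def GeodesicsNotLocallyUnique {Y : Type*} [MetricSpace Y] (x : Y) : Prop :=
  ∀ U ∈ 𝓝 x, ∃ a ∈ U, ∃ b ∈ U, ∃ γ₁ γ₂ : ℝ → Y, IsGeodesicIn U γ₁ a b ∧ IsGeodesicIn U γ₂ a b ∧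
    ∃ t ∈ Icc 0 (dist a b), γ₁ t ≠ γ₂ t

/-- Every point of some open dense set has a neighbourhood in which the curvature is non-positive,
and at every point outside of that set the curvature is `+∞`. -/
def GenericallyNonPositivelyCurved (Y : Type*) [MetricSpace Y] : Prop :=
  ∃ G : Set Y, IsOpen G ∧ Dense G ∧
    (∀ x ∈ G, ∃ U ∈ 𝓝 x, ∀ y ∈ U, CurvatureAtMost 0 y) ∧
    ∀ x ∉ G, CurvatureInfinite x

end Curvature

/-! ### Ordered binary trees and pre-shapes -/

/-- A finite rooted ordered binary tree. A vertex is addressed by the word of left (`false`) and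
right (`true`) turns that leads to it from the root `[]`; an edge is addressed by its lower
endpoint. -/
structure BinaryTree where
  edges : Finset (List Bool)
  nil_notMem : [] ∉ edges
  parent_mem : ∀ (w : List Bool) (b : Bool), w ++ [b] ∈ edges → w ≠ [] → w ∈ edges

/-- The type of edges of the tree. -/
abbrev BinaryTree.Edge (T : BinaryTree) : Type := {w : List Bool // w ∈ T.edges}

/-- The attribute space `(ℝ^d)^n`, with its Euclidean norm. -/
abbrev Attr (d n : ℕ) : Type := PiLp 2 (fun _ : Fin n => EuclideanSpace ℝ (Fin d))

/-- The space of pre-shapes `X = ∏_{e ∈ E} A`. For `p = 1` its distance is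
`∑ₑ ‖xₑ - yₑ‖`, for `p = 2` it is `√(∑ₑ ‖xₑ - yₑ‖²)`. -/
abbrev PreShape (T : BinaryTree) (A : Type) [NormedAddCommGroup A] (p : ℝ≥0∞) : Type :=
  PiLp p (fun _ : T.Edge => A)

/-- A bijection between two sets of edges is an isomorphism of the ordered trees that are obtained
by collapsing all other edges: it preserves the ancestor relation (the prefix relation of
addresses) and the depth-first order (the lexicographic order of addresses). -/
def IsOrderedTreeIso {T : BinaryTree} {S S' : Set T.Edge} (φ : S ≃ S') : Prop :=
  ∀ e f : S, (e.1.1 <+: f.1.1 ↔ (φ e).1.1 <+: (φ f).1.1) ∧ (e.1.1 < f.1.1 ↔ (φ e).1.1 < (φ f).1.1)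

/-- Two sets of edges have the same topology: collapsing all other edges gives isomorphic ordered
trees. -/
def SameTopology {T : BinaryTree} (S S' : Set T.Edge) : Prop :=
  ∃ φ : S ≃ S', IsOrderedTreeIso φ

/-- Two pre-shapes represent the same ordered tree-shape: after collapsing the edges with zero
attribute they are identical as ordered attributed trees. -/
def SameShape {T : BinaryTree} {A : Type} [NormedAddCommGroup A] {p : ℝ≥0∞}
    (x y : PreShape T A p) : Prop :=
  ∃ φ : {e | x e ≠ 0} ≃ {e | y e ≠ 0}, IsOrderedTreeIso φ ∧ ∀ e, y (φ e).1 = x e.1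

theorem SameShape.refl {T : BinaryTree} {A : Type} [NormedAddCommGroup A] {p : ℝ≥0∞}
    (x : PreShape T A p) : SameShape x x :=
  ⟨Equiv.refl _, fun _ _ => ⟨Iff.rfl, Iff.rfl⟩, fun _ => rfl⟩

theorem SameShape.symm {T : BinaryTree} {A : Type} [NormedAddCommGroup A] {p : ℝ≥0∞}
    {x y : PreShape T A p} (h : SameShape x y) : SameShape y x := by
  obtain ⟨φ, h1, h2⟩ := h
  refine ⟨φ.symm, fun e f => ?_, fun e => ?_⟩
  · have := h1 (φ.symm e) (φ.symm f)
    simp only [Equiv.apply_symm_apply] at this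
    exact ⟨this.1.symm, this.2.symm⟩
  · have := h2 (φ.symm e)
    simp only [Equiv.apply_symm_apply] at this
    exact this.symm

theorem SameShape.trans {T : BinaryTree} {A : Type} [NormedAddCommGroup A] {p : ℝ≥0∞}
    {x y z : PreShape T A p} (h : SameShape x y) (h' : SameShape y z) : SameShape x z := by
  obtain ⟨φ, h1, h2⟩ := h
  obtain ⟨ψ, h3, h4⟩ := h'
  exact ⟨φ.trans ψ, fun e f => ⟨(h1 e f).1.trans (h3 _ _).1, (h1 e f).2.trans (h3 _ _).2⟩,
    fun e => (h4 _).trans (h2 e)⟩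

/-! ### Restricted spaces of tree-shapes -/

/-- A family of tree topologies, each given by its sets of non-collapsed edges; with a set of edges
the family contains every other representation of the same topology. -/
structure TopologyFamily (T : BinaryTree) where
  carrier : Set (Set T.Edge)
  mem_of_sameTopology : ∀ S ∈ carrier, ∀ S', SameTopology S S' → S' ∈ carrier

/-- The family of all topologies. -/
def TopologyFamily.all (T : BinaryTree) : TopologyFamily T where
  carrier := univ
  mem_of_sameTopology := fun _ _ _ _ => mem_univ _

/-- The restricted pre-shape space `Z`, the union of the coordinate subspaces `Z_S` of the
topologies `S` of the family. -/
def restrictedPreShapes {T : BinaryTree} (F : TopologyFamily T) (A : Type) [NormedAddCommGroup A]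
    (p : ℝ≥0∞) : Set (PreShape T A p) :=
  ⋃ S ∈ F.carrier, {x | ∀ e ∉ S, x e = 0}

theorem restrictedPreShapes_all (T : BinaryTree) (A : Type) [NormedAddCommGroup A] (p : ℝ≥0∞) :
    restrictedPreShapes (TopologyFamily.all T) A p = univ := by
  refine eq_univ_of_forall fun x => ?_
  simp only [restrictedPreShapes, mem_iUnion]
  exact ⟨univ, mem_univ _, fun e he => absurd (mem_univ e) he⟩

/-- The identification of pre-shapes in `Z` that represent the same tree-shape. -/
def shapeSetoid {T : BinaryTree} (F : TopologyFamily T) (A : Type) [NormedAddCommGroup A]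
    (p : ℝ≥0∞) : Setoid (restrictedPreShapes F A p) where
  r x y := SameShape x.1 y.1
  iseqv := ⟨fun x => SameShape.refl x.1, SameShape.symm, SameShape.trans⟩

/-- The restricted space of ordered tree-shapes `Z̄ = Z / ∼`, to be endowed with the quotient metric
that comes from the `p`-metric on pre-shapes. -/
def RestrictedShapeSpace {T : BinaryTree} (F : TopologyFamily T) (A : Type) [NormedAddCommGroup A]
    (p : ℝ≥0∞) : Type :=
  Quotient (shapeSetoid F A p)

/-- The space of all ordered tree-shapes `X̄ = X / ∼`. -/
abbrev ShapeSpace (T : BinaryTree) (A : Type) [NormedAddCommGroup A] (p : ℝ≥0∞) : Type :=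
  RestrictedShapeSpace (TopologyFamily.all T) A p

/-- The tree-shape represented by a pre-shape. -/
def shape {T : BinaryTree} {F : TopologyFamily T} {A : Type} [NormedAddCommGroup A] {p : ℝ≥0∞}
    (x : restrictedPreShapes F A p) : RestrictedShapeSpace F A p :=
  Quotient.mk (shapeSetoid F A p) x

/-- `IsChain a b L`: there are segments `[x₁, y₁], …, [x_k, y_k]` in `Z` of total length `L` such
that `x₁` represents `a`, `y_i ∼ x_{i+1}` for all `i`, and `y_k` represents `b`. (For `Z = X` the
condition that the segments lie in `Z` is void.) -/
inductive IsChain {T : BinaryTree} {F : TopologyFamily T} {A : Type} [NormedAddCommGroup A]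
    [NormedSpace ℝ A] {p : ℝ≥0∞} [Fact (1 ≤ p)] :
    RestrictedShapeSpace F A p → RestrictedShapeSpace F A p → ℝ → Prop
  | single (x y : restrictedPreShapes F A p)
      (h : segment ℝ x.1 y.1 ⊆ restrictedPreShapes F A p) :
      IsChain (shape x) (shape y) (dist x.1 y.1)
  | cons (x y : restrictedPreShapes F A p) (b : RestrictedShapeSpace F A p) (L : ℝ)
      (h : segment ℝ x.1 y.1 ⊆ restrictedPreShapes F A p) (hL : IsChain (shape y) b L) :
      IsChain (shape x) b (dist x.1 y.1 + L)

/-- The quotient distance: the infimum of the lengths of all chains. -/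
def quotientDist {T : BinaryTree} {F : TopologyFamily T} {A : Type} [NormedAddCommGroup A]
    [NormedSpace ℝ A] {p : ℝ≥0∞} [Fact (1 ≤ p)] (a b : RestrictedShapeSpace F A p) : ℝ :=
  sInf {L | IsChain a b L}

/-! ### The quotient distance is a metric -/

section Metric

variable {T : BinaryTree} {F : TopologyFamily T} {A : Type} [NormedAddCommGroup A]
  [NormedSpace ℝ A] {p : ℝ≥0∞} [Fact (1 ≤ p)]

theorem shape_eq_iff {x y : restrictedPreShapes F A p} :
    shape x = shape y ↔ SameShape x.1 y.1 :=
  Quotient.eq (r := shapeSetoid F A p)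

theorem exists_shape (a : RestrictedShapeSpace F A p) : ∃ x, shape x = a :=
  Quotient.exists_rep a

theorem IsChain.nonneg {a b : RestrictedShapeSpace F A p} {L : ℝ} (h : IsChain a b L) : 0 ≤ L := by
  induction h with
  | single x y h => exact dist_nonneg
  | cons x y b L h hL ih => exact add_nonneg dist_nonneg ih

theorem IsChain.append {a b c : RestrictedShapeSpace F A p} {L L' : ℝ} (h : IsChain a b L)
    (h' : IsChain b c L') : IsChain a c (L + L') := by
  induction h with
  | single x y h => exact IsChain.cons x y c L' h h'
  | cons x y b L h hL ih =>
    rw [add_assoc]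
    exact IsChain.cons x y c _ h (ih h')

theorem IsChain.reverse {a b : RestrictedShapeSpace F A p} {L : ℝ} (h : IsChain a b L) :
    IsChain b a L := by
  induction h with
  | single x y h =>
    rw [dist_comm]
    exact IsChain.single y x (by rwa [segment_symm])
  | cons x y b L h hL ih =>
    rw [add_comm, dist_comm]
    exact ih.append (IsChain.single y x (by rwa [segment_symm]))

theorem exists_isChain (a b : RestrictedShapeSpace F A p) : ∃ L, IsChain a b L := by
  have key : ∀ x : restrictedPreShapes F A p, ∃ z : restrictedPreShapes F A p, z.1 = 0 ∧
      segment ℝ x.1 z.1 ⊆ restrictedPreShapes F A p := by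
    rintro ⟨x, hx⟩
    have hx' := hx
    simp only [restrictedPreShapes, mem_iUnion] at hx'
    obtain ⟨S, hS, hxS⟩ := hx'
    have hmem : ∀ y : PreShape T A p, (∀ e ∉ S, y e = 0) → y ∈ restrictedPreShapes F A p := by
      intro y hy
      simp only [restrictedPreShapes, mem_iUnion]
      exact ⟨S, hS, hy⟩
    refine ⟨⟨0, hmem 0 fun _ _ => rfl⟩, rfl, ?_⟩
    rintro y ⟨s, t, -, -, -, rfl⟩
    refine hmem _ fun e he => ?_
    simp [hxS e he]
  obtain ⟨x, rfl⟩ := exists_shape a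
  obtain ⟨y, rfl⟩ := exists_shape b
  obtain ⟨z, hz, hxz⟩ := key x
  obtain ⟨w, hw, hyw⟩ := key y
  obtain rfl : z = w := Subtype.ext (hz.trans hw.symm)
  exact ⟨_, (IsChain.single x z hxz).append (IsChain.single y z hyw).reverse⟩

theorem bddBelow_isChain (a b : RestrictedShapeSpace F A p) : BddBelow {L | IsChain a b L} :=
  ⟨0, fun _ h => IsChain.nonneg h⟩

theorem finite_sameShape (x : PreShape T A p) : {x' | SameShape x x'}.Finite := by
  have hfin : ((insert (0 : A) (range fun e => x e))).Finite := (finite_range _).insert 0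
  have h := Set.Finite.pi' (ι := T.Edge) (t := fun _ => insert (0 : A) (range fun e => x e))
    fun _ => hfin
  refine (h.preimage (f := fun z : PreShape T A p => z.ofLp)
    (WithLp.ofLp_injective p).injOn).subset ?_
  rintro x' ⟨φ, -, hφ⟩ e
  by_cases he : x' e = 0
  · exact Or.inl he
  · refine Or.inr ⟨(φ.symm ⟨e, he⟩).1, ?_⟩
    have := hφ (φ.symm ⟨e, he⟩)
    rw [Equiv.apply_symm_apply] at this
    exact this.symm

/-- A pre-shape that is obtained from `y` by collapsing edges and modifying attributes can be
carried along an identification of `y` with another pre-shape. -/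
theorem exists_transport {x y y' : PreShape T A p} (h : ∀ e, x e ≠ 0 → y e ≠ 0)
    (hy : SameShape y y') :
    ∃ x' : PreShape T A p, SameShape x x' ∧ ∑ e, ‖x' e - y' e‖ = ∑ e, ‖x e - y e‖ := by
  classical
  obtain ⟨φ, hφ, hφy⟩ := hy
  let x' : PreShape T A p := WithLp.toLp p fun e => if he : y' e ≠ 0 then x (φ.symm ⟨e, he⟩).1 else 0
  have hx' : ∀ e : {e | y e ≠ 0}, x' (φ e).1 = x e.1 := by
    intro e
    have he : y' (φ e).1 ≠ 0 := (φ e).2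
    simp only [x', dif_pos he]
    rw [Subtype.coe_eta, Equiv.symm_apply_apply]
  have hx'0 : ∀ e, y' e = 0 → x' e = 0 := by
    intro e he
    simp [x', he]
  have hsub : ∀ e, x' e ≠ 0 → y' e ≠ 0 := fun e he h0 => he (hx'0 e h0)
  refine ⟨x', ⟨⟨fun e => ⟨(φ ⟨e.1, h e.1 e.2⟩).1, ?_⟩, fun f => ⟨(φ.symm ⟨f.1, hsub f.1 f.2⟩).1, ?_⟩,
    ?_, ?_⟩, ?_, ?_⟩, ?_⟩
  · have := hx' ⟨e.1, h e.1 e.2⟩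
    exact fun h0 => e.2 (this.symm.trans h0)
  · have := hx' (φ.symm ⟨f.1, hsub f.1 f.2⟩)
    rw [Equiv.apply_symm_apply] at this
    exact fun h0 => f.2 (this.trans h0)
  · intro e
    simp
  · intro e
    simp
  · intro e f
    exact hφ ⟨e.1, h e.1 e.2⟩ ⟨f.1, h f.1 f.2⟩
  · intro e
    exact hx' ⟨e.1, h e.1 e.2⟩
  · have key : ∀ (S : Set T.Edge) [Fintype S] (g : T.Edge → ℝ), (∀ e ∉ S, g e = 0) →
        ∑ e : S, g e.1 = ∑ e, g e := by
      intro S _ g hg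
      refine Finset.sum_of_injOn (s := Finset.univ) (t := Finset.univ) (f := fun e : S => g e.1)
        (g := g) (Subtype.val : S → T.Edge) Subtype.val_injective.injOn (fun _ _ => by simp) ?_
        fun _ _ => rfl
      intro e _ he
      refine hg e fun heS => he ⟨⟨e, heS⟩, by simp, rfl⟩
    rw [← key {e | y' e ≠ 0} (fun e => ‖x' e - y' e‖), ← key {e | y e ≠ 0} fun e => ‖x e - y e‖]
    · refine Eq.symm (Fintype.sum_equiv φ _ _ fun e => ?_)
      rw [hx' e, hφy e]
    · intro e he
      have he0 : y e = 0 := by simpa using he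
      have : x e = 0 := by
        by_contra h0
        exact h e h0 he0
      simp [he0, this]
    · intro e he
      have he0 : y' e = 0 := by simpa using he
      simp [he0, hx'0 e he0]

theorem sum_norm_le (x y : PreShape T A p) :
    ∑ e, ‖x e - y e‖ ≤ (Fintype.card T.Edge : ℝ) * dist x y := by
  have : ∀ e ∈ (Finset.univ : Finset T.Edge), ‖x e - y e‖ ≤ dist x y := by
    intro e _
    rw [dist_eq_norm]
    exact PiLp.norm_apply_le (x - y) e
  simpa using Finset.sum_le_card_nsmul _ _ _ this

theorem IsChain.exists_near {x₀ : PreShape T A p} {δ : ℝ} (hδ : ∀ e, x₀ e ≠ 0 → δ ≤ ‖x₀ e‖)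
    {a b : RestrictedShapeSpace F A p} {L : ℝ} (h : IsChain a b L) :
    ∀ (y z : restrictedPreShapes F A p), shape y = a → shape z = b →
      ∀ x, SameShape x₀ x → ∑ e, ‖x e - y.1 e‖ + (Fintype.card T.Edge : ℝ) * L < δ →
        ∃ x', SameShape x₀ x' ∧
          ∑ e, ‖x' e - z.1 e‖ ≤ ∑ e, ‖x e - y.1 e‖ + (Fintype.card T.Edge : ℝ) * L := by
  have hcard : (0 : ℝ) ≤ Fintype.card T.Edge := Nat.cast_nonneg _
  -- near a representative of the given shape, an identification can be followed
  have step : ∀ (y y' x : PreShape T A p), SameShape x₀ x → SameShape y y' →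
      ∑ e, ‖x e - y e‖ < δ →
      ∃ x', SameShape x₀ x' ∧ ∑ e, ‖x' e - y' e‖ = ∑ e, ‖x e - y e‖ := by
    intro y y' x hx hy hlt
    obtain ⟨x', hx', hsum⟩ := exists_transport (x := x) (fun e he hye => by
      obtain ⟨φ, -, hφ⟩ := hx
      have h1 := hφ (φ.symm ⟨e, he⟩)
      rw [Equiv.apply_symm_apply] at h1
      have h2 := hδ _ (φ.symm ⟨e, he⟩).2
      rw [← h1] at h2
      have h3 := Finset.single_le_sum (f := fun e => ‖x e - y e‖) (fun i _ => norm_nonneg _)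
        (Finset.mem_univ e)
      simp only [hye, sub_zero] at h3
      exact absurd (h2.trans h3) (not_le.2 hlt)) hy
    exact ⟨x', hx.trans hx', hsum⟩
  have tri : ∀ x y z : PreShape T A p,
      ∑ e, ‖x e - z e‖ ≤ ∑ e, ‖x e - y e‖ + (Fintype.card T.Edge : ℝ) * dist y z := by
    intro x y z
    refine le_trans ?_ (add_le_add le_rfl (sum_norm_le y z))
    rw [← Finset.sum_add_distrib]
    exact Finset.sum_le_sum fun e _ => norm_sub_le_norm_sub_add_norm_sub _ _ _
  induction h with
  | single u v huv =>
    intro y z hy hz x hx hlt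
    have h0 := mul_nonneg hcard (dist_nonneg (x := u.1) (y := v.1))
    obtain ⟨x₁, hx₁, h1⟩ := step y.1 u.1 x hx (shape_eq_iff.1 hy) (by linarith)
    have h2 := tri x₁ u.1 v.1
    obtain ⟨x₂, hx₂, h3⟩ := step v.1 z.1 x₁ hx₁ (shape_eq_iff.1 hz.symm) (by linarith)
    exact ⟨x₂, hx₂, by linarith⟩
  | cons u v b L huv hL ih =>
    intro y z hy hz x hx hlt
    have hLn := mul_nonneg hcard hL.nonneg
    rw [mul_add] at hlt ⊢
    have h0 := mul_nonneg hcard (dist_nonneg (x := u.1) (y := v.1))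
    obtain ⟨x₁, hx₁, h1⟩ := step y.1 u.1 x hx (shape_eq_iff.1 hy) (by linarith)
    have h2 := tri x₁ u.1 v.1
    obtain ⟨x₂, hx₂, h3⟩ := ih v z rfl hz x₁ hx₁ (by linarith)
    exact ⟨x₂, hx₂, by linarith⟩

theorem eq_of_quotientDist_eq_zero {a b : RestrictedShapeSpace F A p}
    (hab : quotientDist a b = 0) : a = b := by
  obtain ⟨x, rfl⟩ := exists_shape a
  obtain ⟨z, rfl⟩ := exists_shape b
  obtain ⟨δ, hδ0, hδ⟩ : ∃ δ > 0, ∀ e, x.1 e ≠ 0 → δ ≤ ‖x.1 e‖ := by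
    have h : ∀ e : T.Edge, ∃ δ > 0, x.1 e ≠ 0 → δ ≤ ‖x.1 e‖ := by
      intro e
      by_cases he : x.1 e = 0
      · exact ⟨1, one_pos, fun h => absurd he h⟩
      · exact ⟨_, norm_pos_iff.2 he, fun _ => le_rfl⟩
    choose g hg0 hg using h
    obtain hE | hE := isEmpty_or_nonempty T.Edge
    · exact ⟨1, one_pos, fun e => hE.elim e⟩
    · obtain ⟨e₀, he₀⟩ := Finite.exists_min g
      exact ⟨g e₀, hg0 e₀, fun e he => (he₀ e).trans (hg e he)⟩
  have hcard : (0 : ℝ) ≤ Fintype.card T.Edge := Nat.cast_nonneg _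
  have near : ∀ ε > 0, ∃ x', SameShape x.1 x' ∧ ∑ e, ‖x' e - z.1 e‖ < ε := by
    intro ε hε
    have hη : 0 < min δ ε / ((Fintype.card T.Edge : ℝ) + 1) := by positivity
    obtain ⟨L, hL, hLlt⟩ : ∃ L, IsChain (shape x) (shape z) L ∧
        L < min δ ε / ((Fintype.card T.Edge : ℝ) + 1) := by
      by_contra! hcon
      have := le_csInf (s := {L | IsChain (shape x) (shape z) L}) (exists_isChain _ _)
        fun L hL => hcon L hL
      exact absurd (this.trans_eq hab) (not_le.2 hη)
    rw [lt_div_iff₀ (by positivity)] at hLlt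
    have hLn := hL.nonneg
    have hlt : ∑ e, ‖x.1 e - x.1 e‖ + (Fintype.card T.Edge : ℝ) * L < min δ ε := by
      simp only [sub_self, norm_zero, Finset.sum_const_zero]
      nlinarith
    obtain ⟨x', hx', hle⟩ := hL.exists_near hδ x z rfl rfl x.1 (SameShape.refl _)
      (hlt.trans_le (min_le_left _ _))
    exact ⟨x', hx', hle.trans_lt (hlt.trans_le (min_le_right _ _))⟩
  rw [shape_eq_iff]
  obtain ⟨x', hx', hmin⟩ := Set.exists_min_image {x' | SameShape x.1 x'}
    (fun x' => ∑ e, ‖x' e - z.1 e‖) (finite_sameShape x.1) ⟨x.1, SameShape.refl _⟩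
  have h0 : ∑ e, ‖x' e - z.1 e‖ ≤ 0 := by
    by_contra! hpos
    obtain ⟨x'', hx'', hlt⟩ := near _ hpos
    exact absurd (hmin x'' hx'') (not_le.2 hlt)
  have h1 : ∀ e, x' e = z.1 e := by
    intro e
    have h2 := Finset.single_le_sum (f := fun e => ‖x' e - z.1 e‖) (fun i _ => norm_nonneg _)
      (Finset.mem_univ e)
    exact sub_eq_zero.1 (norm_eq_zero.1 (le_antisymm (h2.trans h0) (norm_nonneg _)))
  have h2 : x' = z.1 := PiLp.ext h1
  exact h2 ▸ hx'

/-- The space of tree-shapes with the quotient distance. -/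
instance RestrictedShapeSpace.instMetricSpace : MetricSpace (RestrictedShapeSpace F A p) where
  dist := quotientDist
  dist_self a := by
    obtain ⟨x, rfl⟩ := exists_shape a
    have h : IsChain (shape x) (shape x) (dist x.1 x.1) :=
      IsChain.single x x (by simp [segment_same, x.2])
    rw [dist_self] at h
    exact le_antisymm (csInf_le (bddBelow_isChain _ _) h)
      (le_csInf ⟨0, h⟩ fun _ hL => IsChain.nonneg hL)
  dist_comm a b := by
    have : {L | IsChain a b L} = {L | IsChain b a L} :=
      Set.ext fun L => ⟨IsChain.reverse, IsChain.reverse⟩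
    simp only [quotientDist, this]
  dist_triangle a b c := by
    refine le_of_forall_pos_le_add fun ε hε => ?_
    obtain ⟨L, hL, h1⟩ := Real.lt_sInf_add_pos (s := {L | IsChain a b L}) (exists_isChain a b)
      (half_pos hε)
    obtain ⟨L', hL', h2⟩ := Real.lt_sInf_add_pos (s := {L | IsChain b c L}) (exists_isChain b c)
      (half_pos hε)
    have h3 := csInf_le (bddBelow_isChain a c) (IsChain.append hL hL')
    simp only [quotientDist]
    linarith
  eq_of_dist_eq_zero := eq_of_quotientDist_eq_zero

end Metric

end TreeShape

end

namespace TreeShape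

/-! ### Stewart's theorem in the model planes -/

section Models

open InnerProductGeometry

/-! The quotient is locally a cone. A tree-shape has finitely many representatives, and close to a
representative its nonzero edges stay nonzero. An identification of two pre-shapes is induced by a
permutation of coordinates, which then also identifies all their degenerations, in particular the
nearby representative of the given shape. So dilations about representatives descend to the quotient
(`Separates.exists_transport`, `IsDilation.unique`). Short chains can be dilated by `l` and by
`l⁻¹`, so near the shape such a dilation multiplies distances by exactly `l`.

Consequently a bound `κ` at a shape may be tested on arbitrarily small copies of a fixed triangle.
Stewart's theorem turns comparison with a model plane into a trigonometric inequality between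
distances in the space alone, and the cubic Taylor term of that inequality is Euclidean comparison
(`CurvatureAtMost.zero_of_dilations`). Curvature at a shape is therefore either at most `0` or `+∞`.
The set `G` consists of all shapes of the first kind; it is open because balls in a CAT(0) ball are
convex.

For density, consider shapes to which the family permits no further edge. Around such a shape all
supports are those of its representatives, and a pre-shape is determined by its shape and its
support, so the quotient is locally isometric to a coordinate subspace (`IsMaximal.exists_chart`).
Such shapes are dense by maximality of the number of edges (`exists_isMaximal`), and for exponent
`2` the chart is Euclidean.

For exponent `1` the same chart, at a maximal shape with two edges, contains an ℓ¹ square, whose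
opposite corners are joined by two geodesics along the sides. Density carries this to every point,
and `IsCAT.geodesic_unique` excludes every curvature bound. -/

theorem stewart_sphere {E : Type*} [NormedAddCommGroup E] [InnerProductSpace ℝ E] {A B C P : E}
    (hA : ‖A‖ = 1) (hB : ‖B‖ = 1) (hC : ‖C‖ = 1) (hP : ‖P‖ = 1) {t w : ℝ}
    (hBP : angle B P = t) (hPC : angle P C = w - t) (hBC : angle B C = w) :
    Real.sin w * Real.cos (angle A P) =
      Real.sin (w - t) * Real.cos (angle A B) + Real.sin t * Real.cos (angle A C) := by
  have hin : ∀ {u v : E}, ‖u‖ = 1 → ‖v‖ = 1 → inner ℝ u v = Real.cos (angle u v) := by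
    intro u v hu hv
    rw [cos_angle, hu, hv]; simp
  have h1 := hin hB hP
  have h2 := hin hP hC
  have h3 := hin hB hC
  rw [hBP] at h1
  rw [hPC] at h2
  rw [hBC] at h3
  have hPB : inner ℝ P B = Real.cos t := by rw [real_inner_comm, h1]
  have hCP : inner ℝ C P = Real.cos (w - t) := by rw [real_inner_comm, h2]
  have hCB : inner ℝ C B = Real.cos w := by rw [real_inner_comm, h3]
  have hself : ∀ {u : E}, ‖u‖ = 1 → inner ℝ u u = 1 := fun hu => by
    rw [real_inner_self_eq_norm_sq, hu, one_pow]
  -- `P` lies on the arc from `B` to `C`. The squared norm is computed instead of solving for `P`,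
  -- so `sin w = 0` needs no separate treatment.
  have hV : Real.sin w • P - Real.sin (w - t) • B - Real.sin t • C = 0 := by
    rw [← inner_self_eq_zero (𝕜 := ℝ)]
    simp only [inner_sub_left, inner_sub_right, real_inner_smul_left, real_inner_smul_right,
      hself hB, hself hC, hself hP, h1, h2, h3, hPB, hCP, hCB]
    rw [Real.sin_sub, Real.cos_sub]
    linear_combination (-Real.sin w ^ 2) * Real.sin_sq_add_cos_sq t -
      Real.sin t ^ 2 * Real.sin_sq_add_cos_sq w
  have h := congrArg (fun v => inner ℝ A v) hV
  simp only [inner_sub_right, real_inner_smul_right, inner_zero_right, hin hA hB, hin hA hC,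
    hin hA hP] at h
  linarith

theorem stewart_upperHalfPlane {A B C P : UpperHalfPlane} {t w : ℝ}
    (hBP : dist B P = t) (hPC : dist P C = w - t) (hBC : dist B C = w) :
    Real.sinh w * Real.cosh (dist A P) =
      Real.sinh (w - t) * Real.cosh (dist A B) + Real.sinh t * Real.cosh (dist A C) := by
  -- The hyperboloid model: a point becomes a positive definite symmetric matrix with entries `p, r,
  -- r, q` and determinant `1`, and `cosh` of the distance is the polarized determinant.
  obtain ⟨p, q, r, hp, hq, hpq, hQ⟩ : ∃ p q r : UpperHalfPlane → ℝ, (∀ z, 0 < p z) ∧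
      (∀ z, 0 < q z) ∧ (∀ z, p z * q z - r z ^ 2 = 1) ∧ ∀ z z' : UpperHalfPlane,
        Real.cosh (dist z z') = (p z * q z' + q z * p z') / 2 - r z * r z' := by
    refine ⟨fun z => (z.re ^ 2 + z.im ^ 2) / z.im, fun z => 1 / z.im, fun z => z.re / z.im,
      fun z => ?_, fun z => ?_, fun z => ?_, fun z z' => ?_⟩
    · have := z.im_pos
      positivity
    · have := z.im_pos
      positivity
    · have := z.im_pos
      field_simp
      ring
    · have h1 := z.im_pos
      have h2 := z'.im_pos
      rw [UpperHalfPlane.cosh_dist, Complex.dist_eq, Complex.sq_norm, Complex.normSq_apply]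
      simp only [Complex.sub_re, Complex.sub_im, UpperHalfPlane.coe_re, UpperHalfPlane.coe_im]
      field_simp
      ring
  have h1 := hQ B P
  have h2 := hQ P C
  have h3 := hQ B C
  rw [hBP] at h1
  rw [hPC, Real.cosh_sub] at h2
  rw [hBC] at h3
  rw [hQ A P, hQ A B, hQ A C, Real.sinh_sub]
  have et := Real.cosh_sq t
  have ew := Real.cosh_sq w
  generalize Real.sinh w = sw at *
  generalize Real.cosh w = cw at *
  generalize Real.sinh t = st at *
  generalize Real.cosh t = ct at *
  obtain ⟨v₁, hv₁⟩ : ∃ v, v = sw * p P - (sw * ct - cw * st) * p B - st * p C := ⟨_, rfl⟩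
  obtain ⟨v₂, hv₂⟩ : ∃ v, v = sw * q P - (sw * ct - cw * st) * q B - st * q C := ⟨_, rfl⟩
  obtain ⟨v₃, hv₃⟩ : ∃ v, v = sw * r P - (sw * ct - cw * st) * r B - st * r C := ⟨_, rfl⟩
  have hB := hpq B
  have hC := hpq C
  have hP := hpq P
  have hVV : v₁ * v₂ - v₃ ^ 2 = 0 := by
    have : v₁ * v₂ - v₃ ^ 2 = sw ^ 2 * (p P * q P - r P ^ 2) +
        (sw * ct - cw * st) ^ 2 * (p B * q B - r B ^ 2) + st ^ 2 * (p C * q C - r C ^ 2)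
        - 2 * sw * (sw * ct - cw * st) * ((p B * q P + q B * p P) / 2 - r B * r P)
        - 2 * sw * st * ((p P * q C + q P * p C) / 2 - r P * r C)
        + 2 * (sw * ct - cw * st) * st * ((p B * q C + q B * p C) / 2 - r B * r C) := by
      rw [hv₁, hv₂, hv₃]
      ring
    rw [this, hB, hC, hP, ← h1, ← h2, ← h3]
    linear_combination (-sw ^ 2) * et - st ^ 2 * ew
  have hVP : (v₁ * q P + v₂ * p P) / 2 - v₃ * r P = 0 := by
    have : (v₁ * q P + v₂ * p P) / 2 - v₃ * r P = sw * (p P * q P - r P ^ 2)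
        - (sw * ct - cw * st) * ((p B * q P + q B * p P) / 2 - r B * r P)
        - st * ((p P * q C + q P * p C) / 2 - r P * r C) := by
      rw [hv₁, hv₂, hv₃]
      ring
    rw [this, hP, ← h1, ← h2]
    linear_combination (-sw) * et
  -- The form has Lorentzian signature, so a null vector orthogonal to the timelike vector `P`
  -- vanishes; this is a sum of squares that certifies it.
  have h4 : (v₁ * q P - v₂ * p P) ^ 2 + 4 * v₃ ^ 2 = 0 := by
    linear_combination (2 * (v₁ * q P + v₂ * p P) + 4 * v₃ * r P) * hVP +
      (-4 * p P * q P) * hVV - 4 * v₃ ^ 2 * hP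
  have h5 : v₃ = 0 := pow_eq_zero_iff two_ne_zero |>.1 <| by
    linarith [sq_nonneg (v₁ * q P - v₂ * p P), sq_nonneg v₃]
  have h6 : v₁ * q P - v₂ * p P = 0 := pow_eq_zero_iff two_ne_zero |>.1 <| by
    linarith [sq_nonneg (v₁ * q P - v₂ * p P), sq_nonneg v₃]
  have h7 : v₁ * q P + v₂ * p P = 0 := by
    rw [h5] at hVP
    linarith
  have h8 : v₁ = 0 := by
    have : v₁ * q P = 0 := by linarith
    exact (mul_eq_zero.1 this).resolve_right (hq P).ne'
  have h9 : v₂ = 0 := by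
    have : v₂ * p P = 0 := by linarith
    exact (mul_eq_zero.1 this).resolve_right (hp P).ne'
  rw [h8] at hv₁
  rw [h9] at hv₂
  rw [h5] at hv₃
  linear_combination (-q A / 2) * hv₁ + (-p A / 2) * hv₂ + r A * hv₃

theorem stewart_inner {E : Type*} [NormedAddCommGroup E] [InnerProductSpace ℝ E] {A B C P : E}
    {t w : ℝ} (hBP : dist B P = t) (hPC : dist P C = w - t) (hBC : dist B C = w) :
    w * dist A P ^ 2 = (w - t) * dist A B ^ 2 + t * dist A C ^ 2 - w * t * (w - t) := by
  have hsq : ∀ u : E, ‖u‖ ^ 2 = inner ℝ u u := fun u => (real_inner_self_eq_norm_sq u).symm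
  rw [dist_comm, dist_eq_norm] at hBP hPC hBC
  simp only [dist_eq_norm]
  rw [show C - P = (C - B) - (P - B) by abel] at hPC
  rw [show A - P = (A - B) - (P - B) by abel, show A - C = (A - B) - (C - B) by abel]
  generalize P - B = x at *
  generalize C - B = y at *
  generalize A - B = z at *
  have h1 : inner ℝ x x = t ^ 2 := by rw [← hBP, hsq]
  have h2 : inner ℝ y y = w ^ 2 := by rw [← hBC, hsq]
  have h3 : inner ℝ x y = w * t := by
    have := norm_sub_sq_real y x
    rw [hPC, hBP, hBC, real_inner_comm] at this
    linarith
  have hV : w • x - t • y = 0 := by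
    rw [← inner_self_eq_zero (𝕜 := ℝ)]
    simp only [inner_sub_left, inner_sub_right, real_inner_smul_left, real_inner_smul_right, h1, h2,
      h3, real_inner_comm x y]
    ring
  have hz := congrArg (fun v => inner ℝ z v) hV
  simp only [inner_sub_right, real_inner_smul_right, inner_zero_right] at hz
  rw [norm_sub_sq_real, norm_sub_sq_real, hBP, hBC]
  linear_combination (-2) * hz

end Models

/-! ### Infinitesimal comparison -/

theorem tendsto_sin_sub_div_cube (u : ℝ) :
    Tendsto (fun s : ℝ => (Real.sin (s * u) - s * u) / s ^ 3) (𝓝[>] 0) (𝓝 (-(u ^ 3 / 6))) := by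
  rw [tendsto_iff_norm_sub_tendsto_zero]
  have hlim : Tendsto (fun s : ℝ => |u| ^ 5 * s ^ 2) (𝓝[>] 0) (𝓝 0) := by
    have : Tendsto (fun s : ℝ => |u| ^ 5 * s ^ 2) (𝓝 0) (𝓝 (|u| ^ 5 * 0 ^ 2)) :=
      (by fun_prop : Continuous fun s : ℝ => |u| ^ 5 * s ^ 2).tendsto 0
    simpa using this.mono_left nhdsWithin_le_nhds
  have hsmall : ∀ᶠ s : ℝ in 𝓝[>] 0, |s * u| ≤ 1 := by
    have : Tendsto (fun s : ℝ => |s * u|) (𝓝 0) (𝓝 |0 * u|) :=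
      (by fun_prop : Continuous fun s : ℝ => |s * u|).tendsto 0
    rw [zero_mul, abs_zero] at this
    exact nhdsWithin_le_nhds (this.eventually_le_const one_pos)
  refine squeeze_zero' (Eventually.of_forall fun _ => norm_nonneg _) ?_ hlim
  filter_upwards [hsmall, self_mem_nhdsWithin] with s hs (hs0 : 0 < s)
  have h := Real.sin_bound hs
  have e : (Real.sin (s * u) - s * u) / s ^ 3 - -(u ^ 3 / 6) =
      (Real.sin (s * u) - (s * u - (s * u) ^ 3 / 6)) / s ^ 3 := by
    field_simp
    ring
  rw [e, Real.norm_eq_abs, abs_div, abs_of_pos (pow_pos hs0 3), div_le_iff₀ (pow_pos hs0 3)]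
  refine h.trans ?_
  rw [abs_mul, abs_of_pos hs0, mul_pow]
  have : 0 ≤ s ^ 5 * |u| ^ 5 := by positivity
  nlinarith

/-- The Taylor bound for the complex sine, evaluated at `x * I`, where `sin (x * I) = sinh x * I`.
-/
theorem abs_sinh_sub_le {x : ℝ} (hx : |x| ≤ 1) : |Real.sinh x - (x + x ^ 3 / 6)| ≤ |x| ^ 5 / 100 := by
  have h := Complex.sin_bound (x := (x : ℂ) * Complex.I) (by simpa using hx)
  rw [Complex.sin_mul_I, ← Complex.ofReal_sinh] at h
  have e : (Real.sinh x : ℂ) * Complex.I - (x * Complex.I - (x * Complex.I) ^ 3 / 6) =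
      ((Real.sinh x - (x + x ^ 3 / 6) : ℝ) : ℂ) * Complex.I := by
    push_cast
    linear_combination ((x : ℂ) ^ 3 * Complex.I / 6) * Complex.I_sq
  rw [e, norm_mul, norm_mul, Complex.norm_I, mul_one, mul_one, Complex.norm_real,
    Complex.norm_real] at h
  exact h

theorem tendsto_sinh_sub_div_cube (u : ℝ) :
    Tendsto (fun s : ℝ => (Real.sinh (s * u) - s * u) / s ^ 3) (𝓝[>] 0) (𝓝 (u ^ 3 / 6)) := by
  rw [tendsto_iff_norm_sub_tendsto_zero]
  have hlim : Tendsto (fun s : ℝ => |u| ^ 5 * s ^ 2) (𝓝[>] 0) (𝓝 0) := by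
    have : Tendsto (fun s : ℝ => |u| ^ 5 * s ^ 2) (𝓝 0) (𝓝 (|u| ^ 5 * 0 ^ 2)) :=
      (by fun_prop : Continuous fun s : ℝ => |u| ^ 5 * s ^ 2).tendsto 0
    simpa using this.mono_left nhdsWithin_le_nhds
  have hsmall : ∀ᶠ s : ℝ in 𝓝[>] 0, |s * u| ≤ 1 := by
    have : Tendsto (fun s : ℝ => |s * u|) (𝓝 0) (𝓝 |0 * u|) :=
      (by fun_prop : Continuous fun s : ℝ => |s * u|).tendsto 0
    rw [zero_mul, abs_zero] at this
    exact nhdsWithin_le_nhds (this.eventually_le_const one_pos)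
  refine squeeze_zero' (Eventually.of_forall fun _ => norm_nonneg _) ?_ hlim
  filter_upwards [hsmall, self_mem_nhdsWithin] with s hs (hs0 : 0 < s)
  have h := abs_sinh_sub_le hs
  have e : (Real.sinh (s * u) - s * u) / s ^ 3 - u ^ 3 / 6 =
      (Real.sinh (s * u) - (s * u + (s * u) ^ 3 / 6)) / s ^ 3 := by
    field_simp
    ring
  rw [e, Real.norm_eq_abs, abs_div, abs_of_pos (pow_pos hs0 3), div_le_iff₀ (pow_pos hs0 3)]
  refine h.trans ?_
  rw [abs_mul, abs_of_pos hs0, mul_pow]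
  have : 0 ≤ s ^ 5 * |u| ^ 5 := by positivity
  nlinarith

/-- Rescaling spherical comparison to small triangles gives Euclidean comparison. -/
theorem stewart_of_eventually_sphere {w t p q m : ℝ}
    (h : ∀ᶠ s : ℝ in 𝓝[>] 0, Real.sin (s * (w - t)) * Real.cos (s * p) +
      Real.sin (s * t) * Real.cos (s * q) ≤ Real.sin (s * w) * Real.cos (s * m)) :
    w * m ^ 2 ≤ (w - t) * p ^ 2 + t * q ^ 2 - w * t * (w - t) := by
  -- The identity `2 sin a cos b = sin (a + b) + sin (a - b)` produces these six sines. Their linear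
  -- terms cancel, and `w³ - (w - t)³ - t³ = 3wt(w - t)` identifies the cubic coefficient.
  have hlim := ((((((tendsto_sin_sub_div_cube (w + m)).add (tendsto_sin_sub_div_cube (w - m))).sub
    (tendsto_sin_sub_div_cube (w - t + p))).sub (tendsto_sin_sub_div_cube (w - t - p))).sub
    (tendsto_sin_sub_div_cube (t + q))).sub (tendsto_sin_sub_div_cube (t - q)))
  have := ge_of_tendsto (b := 0) hlim (by
    filter_upwards [h, self_mem_nhdsWithin] with s hs (hs0 : 0 < s)
    rw [← add_div, ← sub_div, ← sub_div, ← sub_div, ← sub_div]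
    refine div_nonneg ?_ (pow_pos hs0 3).le
    rw [mul_add s w m, mul_sub s w m, mul_add s (w - t) p, mul_sub s (w - t) p, mul_add s t q,
      mul_sub s t q, Real.sin_add, Real.sin_sub (s * w), Real.sin_add (s * (w - t)),
      Real.sin_sub (s * (w - t)), Real.sin_add (s * t), Real.sin_sub (s * t)]
    linarith)
  linarith

/-- Rescaling hyperbolic comparison to small triangles gives Euclidean comparison. -/
theorem stewart_of_eventually_hyperbolic {w t p q m : ℝ}
    (h : ∀ᶠ s : ℝ in 𝓝[>] 0, Real.sinh (s * w) * Real.cosh (s * m) ≤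
      Real.sinh (s * (w - t)) * Real.cosh (s * p) + Real.sinh (s * t) * Real.cosh (s * q)) :
    w * m ^ 2 ≤ (w - t) * p ^ 2 + t * q ^ 2 - w * t * (w - t) := by
  have hlim := ((((((tendsto_sinh_sub_div_cube (w + m)).add
    (tendsto_sinh_sub_div_cube (w - m))).sub
    (tendsto_sinh_sub_div_cube (w - t + p))).sub (tendsto_sinh_sub_div_cube (w - t - p))).sub
    (tendsto_sinh_sub_div_cube (t + q))).sub (tendsto_sinh_sub_div_cube (t - q)))
  have := le_of_tendsto (b := 0) hlim (by
    filter_upwards [h, self_mem_nhdsWithin] with s hs (hs0 : 0 < s)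
    rw [← add_div, ← sub_div, ← sub_div, ← sub_div, ← sub_div]
    refine div_nonpos_of_nonpos_of_nonneg ?_ (pow_pos hs0 3).le
    rw [mul_add s w m, mul_sub s w m, mul_add s (w - t) p, mul_sub s (w - t) p, mul_add s t q,
      mul_sub s t q, Real.sinh_add, Real.sinh_sub (s * w), Real.sinh_add (s * (w - t)),
      Real.sinh_sub (s * (w - t)), Real.sinh_add (s * t), Real.sinh_sub (s * t)]
    linarith)
  linarith


/-! ### Consequences and reformulations of the comparison inequality -/

section Comparison

variable {Y : Type*} [MetricSpace Y] {a b c : Y} {γ : ℝ → Y} {κ : ℝ}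

/-- Stewart's theorem as an inequality: `γ t` is at most as far from `a` as the corresponding point
in the Euclidean comparison triangle. -/
def StewartInequality (a b c : Y) (γ : ℝ → Y) : Prop :=
  ∀ t ∈ Icc 0 (dist b c), dist b c * dist a (γ t) ^ 2 ≤
    (dist b c - t) * dist a b ^ 2 + t * dist a c ^ 2 - dist b c * t * (dist b c - t)

/-- Stewart's formula computes the comparison distance from the sides, and cosine reverses order on
`[0, π]`; the model triangle is thereby eliminated. -/
theorem ComparisonInequality.spherical (h : ComparisonInequality κ a b c γ) (hκ : 0 < κ) {t : ℝ}
    (ht : t ∈ Icc 0 (dist b c)) :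
    Real.sin (√κ * (dist b c - t)) * Real.cos (√κ * dist a b) +
      Real.sin (√κ * t) * Real.cos (√κ * dist a c) ≤
        Real.sin (√κ * dist b c) * Real.cos (√κ * dist a (γ t)) := by
  have hk : 0 < √κ := Real.sqrt_pos.2 hκ
  obtain ⟨A, B, C, hAB, hAC, hBC, hP⟩ := h.1 hκ
  obtain ⟨P, hBP, hPC, hAP⟩ := hP t ht
  have hn : ∀ u : Metric.sphere (0 : EuclideanSpace ℝ (Fin 3)) 1,
      ‖(u : EuclideanSpace ℝ (Fin 3))‖ = 1 := fun u => norm_eq_of_mem_sphere u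
  rw [div_eq_iff hk.ne', mul_comm] at hAB hAC hBC hBP hPC
  rw [le_div_iff₀ hk, mul_comm] at hAP
  rw [mul_sub] at hPC
  have := stewart_sphere (hn A) (hn B) (hn C) (hn P) hBP hPC hBC
  rw [hAB, hAC] at this
  rw [mul_sub, ← this]
  refine mul_le_mul_of_nonneg_left ?_ ?_
  · exact Real.cos_le_cos_of_nonneg_of_le_pi (by positivity) (InnerProductGeometry.angle_le_pi _ _)
      hAP
  · rw [← hBC]
    exact Real.sin_nonneg_of_nonneg_of_le_pi (InnerProductGeometry.angle_nonneg _ _)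
      (InnerProductGeometry.angle_le_pi _ _)

theorem ComparisonInequality.hyperbolic (h : ComparisonInequality κ a b c γ) (hκ : κ < 0) {t : ℝ}
    (ht : t ∈ Icc 0 (dist b c)) :
    Real.sinh (√(-κ) * dist b c) * Real.cosh (√(-κ) * dist a (γ t)) ≤
      Real.sinh (√(-κ) * (dist b c - t)) * Real.cosh (√(-κ) * dist a b) +
        Real.sinh (√(-κ) * t) * Real.cosh (√(-κ) * dist a c) := by
  have hk : 0 < √(-κ) := Real.sqrt_pos.2 (by linarith)
  obtain ⟨A, B, C, hAB, hAC, hBC, hP⟩ := h.2.2 hκ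
  obtain ⟨P, hBP, hPC, hAP⟩ := hP t ht
  rw [div_eq_iff hk.ne', mul_comm] at hAB hAC hBC hBP hPC
  rw [le_div_iff₀ hk, mul_comm] at hAP
  rw [mul_sub] at hPC
  have := stewart_upperHalfPlane hBP hPC hBC (A := A)
  rw [hAB, hAC] at this
  rw [mul_sub, ← this]
  refine mul_le_mul_of_nonneg_left ?_ (Real.sinh_nonneg_iff.2 (by positivity))
  rw [Real.cosh_le_cosh, abs_of_nonneg (by positivity), abs_of_nonneg dist_nonneg]
  exact hAP

theorem ComparisonInequality.stewartInequality (h : ComparisonInequality 0 a b c γ) :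
    StewartInequality a b c γ := by
  intro t ht
  obtain ⟨A, B, C, hAB, hAC, hBC, hP⟩ := h.2.1 rfl
  obtain ⟨P, hBP, hPC, hAP⟩ := hP t ht
  simp only at hAB hAC hAP
  have := stewart_inner hBP hPC hBC (A := A)
  rw [hAB, hAC] at this
  rw [← this]
  gcongr

/-- Triangles in the Euclidean plane with prescribed sides. -/
theorem exists_euclidean_triangle {p q w : ℝ} (hp : 0 ≤ p) (hw : 0 ≤ w) (h₁ : p ≤ q + w)
    (h₂ : q ≤ p + w) (h₃ : w ≤ p + q) :
    ∃ A B C : EuclideanSpace ℝ (Fin 2), dist A B = p ∧ dist A C = q ∧ dist B C = w := by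
  have hq : 0 ≤ q := by linarith
  obtain ⟨α, β, h4, h5⟩ : ∃ α β : ℝ, α ^ 2 + β ^ 2 = p ^ 2 ∧ (α - w) ^ 2 + β ^ 2 = q ^ 2 := by
    obtain rfl | hw0 := hw.eq_or_lt
    · exact ⟨p, 0, by ring, by rw [show q = p by linarith]; ring⟩
    · have e : (p ^ 2 - q ^ 2 + w ^ 2) / (2 * w) * (2 * w) = p ^ 2 - q ^ 2 + w ^ 2 := by
        field_simp
      generalize (p ^ 2 - q ^ 2 + w ^ 2) / (2 * w) = α at e
      have h6 : 0 ≤ p ^ 2 - α ^ 2 := by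
        have h7 : 0 ≤ p - α := by
          by_contra! hcon
          nlinarith
        have h8 : 0 ≤ p + α := by
          by_contra! hcon
          nlinarith
        nlinarith
      refine ⟨α, √(p ^ 2 - α ^ 2), ?_, ?_⟩ <;> rw [Real.sq_sqrt h6]
      · ring
      · linarith
  refine ⟨!₂[α, β], !₂[0, 0], !₂[w, 0], ?_, ?_, ?_⟩ <;> rw [EuclideanSpace.dist_eq]
  · rw [← Real.sqrt_sq hp, ← h4]
    simp [Real.dist_eq, Fin.sum_univ_two, sq_abs]
  · rw [← Real.sqrt_sq hq, ← h5]
    simp [Real.dist_eq, Fin.sum_univ_two, sq_abs]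
  · simp [Real.dist_eq, Fin.sum_univ_two, sq_abs, Real.sqrt_sq hw]

/-- In the plane Stewart's formula is an equality and can be read backwards. If `b = c` the
inequality is empty, whence the hypothesis on `γ 0`. -/
theorem StewartInequality.comparisonInequality (h : StewartInequality a b c γ) (h0 : γ 0 = b) :
    ComparisonInequality 0 a b c γ := by
  refine ⟨fun hκ => absurd hκ (lt_irrefl _), fun _ => ?_, fun hκ => absurd hκ (lt_irrefl _)⟩
  obtain ⟨A, B, C, hAB, hAC, hBC⟩ := exists_euclidean_triangle (p := dist a b) (q := dist a c)
    (w := dist b c) dist_nonneg dist_nonneg (by rw [dist_comm b c]; exact dist_triangle _ _ _)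
    (dist_triangle _ _ _) (by rw [dist_comm a b]; exact dist_triangle _ _ _)
  refine ⟨A, B, C, hAB, hAC, hBC, fun t ht => ?_⟩
  obtain hw | hw := (dist_nonneg (x := b) (y := c)).eq_or_lt
  · rw [← hw] at ht hBC ⊢
    obtain rfl : t = 0 := le_antisymm ht.2 ht.1
    exact ⟨B, dist_self B, by simpa using hBC, by simp only [h0, hAB, le_refl]⟩
  · have hBP : dist B (AffineMap.lineMap B C (t / dist b c)) = t := by
      rw [dist_left_lineMap, hBC, Real.norm_eq_abs, abs_of_nonneg (div_nonneg ht.1 hw.le)]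
      field_simp
    have hPC : dist (AffineMap.lineMap B C (t / dist b c)) C = dist b c - t := by
      rw [dist_lineMap_right, hBC, Real.norm_eq_abs, abs_of_nonneg]
      · field_simp
      · rw [sub_nonneg, div_le_one hw]
        exact ht.2
    refine ⟨_, hBP, hPC, ?_⟩
    have h1 := stewart_inner hBP hPC hBC (A := A)
    have h2 := h t ht
    rw [hAB, hAC] at h1
    rw [← h1] at h2
    exact (sq_le_sq₀ dist_nonneg dist_nonneg).1 (le_of_mul_le_mul_left h2 hw)

/-- Without its last term, Stewart's inequality bounds the squared distance to `a` by a convex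
combination of the values at the endpoints, so balls are convex. -/
theorem StewartInequality.dist_lt (h : StewartInequality a b c γ) (h0 : γ 0 = b) {r : ℝ}
    (hb : dist a b < r) (hc : dist a c < r) {t : ℝ} (ht : t ∈ Icc 0 (dist b c)) :
    dist a (γ t) < r := by
  obtain hw | hw := (dist_nonneg (x := b) (y := c)).eq_or_lt
  · rw [← hw] at ht
    obtain rfl : t = 0 := le_antisymm ht.2 ht.1
    rwa [h0]
  · have h1 := h t ht
    by_contra! hr
    have hr0 : 0 < r := dist_nonneg.trans_lt hb
    have h2 : dist a b ^ 2 < r ^ 2 := by gcongr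
    have h3 : dist a c ^ 2 < r ^ 2 := by gcongr
    have h4 : r ^ 2 ≤ dist a (γ t) ^ 2 := by gcongr
    have h5 : dist b c * r ^ 2 ≤ dist b c * dist a (γ t) ^ 2 := by gcongr
    have h6 : 0 ≤ dist b c * t * (dist b c - t) :=
      mul_nonneg (mul_nonneg hw.le ht.1) (sub_nonneg.2 ht.2)
    have h7 : (dist b c - t) * dist a b ^ 2 ≤ (dist b c - t) * r ^ 2 :=
      mul_le_mul_of_nonneg_left h2.le (sub_nonneg.2 ht.2)
    have h8 : t * dist a c ^ 2 ≤ t * r ^ 2 := mul_le_mul_of_nonneg_left h3.le ht.1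
    -- Strictness has to come from an endpoint with positive weight: `b` if `t = 0`, otherwise `c`.
    obtain h9 | h9 := ht.1.eq_or_lt
    · have : dist b c * dist a b ^ 2 < dist b c * r ^ 2 := mul_lt_mul_of_pos_left h2 hw
      subst h9
      linarith
    · have : t * dist a c ^ 2 < t * r ^ 2 := mul_lt_mul_of_pos_left h3 h9
      linarith

/-- Geodesics need only be found in the larger set `s`: Stewart's inequality with apex at the centre
`y` keeps them in the ball. -/
theorem isCAT_zero_ball {s : Set Y} {y : Y} {r : ℝ} (hs : Metric.ball y r ⊆ s)
    (hgeo : ∀ a ∈ Metric.ball y r, ∀ b ∈ Metric.ball y r, ∃ γ, IsGeodesicIn s γ a b)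
    (hst : ∀ a ∈ Metric.ball y r, ∀ b ∈ Metric.ball y r, ∀ c ∈ Metric.ball y r, ∀ γ,
      IsGeodesicIn s γ b c → StewartInequality a b c γ) : IsCAT 0 (Metric.ball y r) := by
  refine ⟨fun a ha b hb _ => ?_, fun a ha b hb c hc γ hγ _ => ?_⟩
  · obtain ⟨γ, hγ⟩ := hgeo a ha b hb
    refine ⟨γ, hγ.1, fun t ht => ?_⟩
    have hy : y ∈ Metric.ball y r := Metric.mem_ball_self (dist_nonneg.trans_lt ha)
    rw [Metric.mem_ball'] at ha hb ⊢
    exact (hst y hy a (Metric.mem_ball'.2 ha) b (Metric.mem_ball'.2 hb) γ hγ).dist_lt hγ.1.1 ha hb ht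
  · exact (hst a ha b hb c hc γ ⟨hγ.1, fun t ht => hs (hγ.2 t ht)⟩).comparisonInequality hγ.1.1

theorem isOpen_curvatureAtMost_zero : IsOpen {x : Y | CurvatureAtMost 0 x} := by
  rw [Metric.isOpen_iff]
  rintro x ⟨r, hr, hcat⟩
  refine ⟨r, hr, fun y hy => ?_⟩
  have hsub := Metric.ball_subset_ball' (x := y) (y := x) (ε₁ := r - dist y x) (ε₂ := r) (by simp)
  refine ⟨r - dist y x, sub_pos.2 hy, isCAT_zero_ball hsub ?_ ?_⟩
  · exact fun a ha b hb => hcat.1 a (hsub ha) b (hsub hb) fun h => absurd h (lt_irrefl _)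
  · exact fun a ha b hb c hc γ hγ => (hcat.2 a (hsub ha) b (hsub hb) c (hsub hc) γ hγ
      fun h => absurd h (lt_irrefl _)).stewartInequality

/-- Compare the triangle with apex `γ₁ t` and opposite side `γ₂`. Its comparison triangle is
degenerate, and the comparison point of `γ₂ t` is the apex itself. -/
theorem IsCAT.geodesic_unique {s : Set Y} (h : IsCAT κ s) {γ₁ γ₂ : ℝ → Y}
    (h₁ : IsGeodesicIn s γ₁ b c) (h₂ : IsGeodesicIn s γ₂ b c)
    (hκ : 0 < κ → dist b c < Real.pi / √κ) {t : ℝ} (ht : t ∈ Icc 0 (dist b c)) : γ₁ t = γ₂ t := by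
  have h0 : (0 : ℝ) ∈ Icc 0 (dist b c) := ⟨le_rfl, dist_nonneg⟩
  have hend : dist b c ∈ Icc 0 (dist b c) := ⟨dist_nonneg, le_rfl⟩
  have hb : ∀ {γ}, IsGeodesicIn s γ b c → dist (γ t) b = t := by
    intro γ hγ
    rw [← hγ.1.1, hγ.1.2.2 t ht 0 h0, sub_zero, abs_of_nonneg ht.1]
  have hc : ∀ {γ}, IsGeodesicIn s γ b c → dist (γ t) c = dist b c - t := by
    intro γ hγ
    have := hγ.1.2.2 t ht _ hend
    rw [hγ.1.2.1] at this
    rw [this, abs_sub_comm, abs_of_nonneg (sub_nonneg.2 ht.2)]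
  have hbs : b ∈ s := by simpa [h₁.1.1] using h₁.2 0 h0
  have hcs : c ∈ s := by simpa [h₁.1.2.1] using h₁.2 _ hend
  obtain hw | hw := (dist_nonneg (x := b) (y := c)).eq_or_lt
  · rw [← hw] at ht
    obtain rfl : t = 0 := le_antisymm ht.2 ht.1
    rw [h₁.1.1, h₂.1.1]
  have hcomp := h.2 (γ₁ t) (h₁.2 t ht) b hbs c hcs γ₂ h₂ (fun hκ0 => by
    rw [dist_comm c, hb h₁, hc h₁]
    have := hκ hκ0
    rw [mul_div_assoc]
    linarith)
  -- For `0 < κ` this rules out the other solutions of `cos = 1`.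
  have hm : dist (γ₁ t) (γ₂ t) ≤ dist b c := by
    have e1 := dist_triangle_right (γ₁ t) (γ₂ t) b
    have e2 := dist_triangle_right (γ₁ t) (γ₂ t) c
    rw [hb h₁, hb h₂] at e1
    rw [hc h₁, hc h₂] at e2
    linarith
  rw [← dist_eq_zero]
  obtain hκ0 | rfl | hκ0 := lt_trichotomy κ 0
  · have hk : 0 < √(-κ) := Real.sqrt_pos.2 (by linarith)
    have := hcomp.hyperbolic hκ0 ht
    rw [hb h₁, hc h₁, mul_comm (Real.sinh (√(-κ) * t)), mul_comm (Real.cosh _) (Real.sinh (_ * t)),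
      mul_comm (Real.sinh (√(-κ) * t)), ← Real.sinh_add,
      show √(-κ) * (dist b c - t) + √(-κ) * t = √(-κ) * dist b c by ring] at this
    have hs : 0 < Real.sinh (√(-κ) * dist b c) := Real.sinh_pos_iff.2 (by positivity)
    by_contra hne
    have := Real.one_lt_cosh.2 (mul_ne_zero hk.ne' hne)
    nlinarith
  · have := hcomp.stewartInequality t ht
    rw [hb h₁, hc h₁] at this
    have h3 : dist b c * dist (γ₁ t) (γ₂ t) ^ 2 ≤ 0 := by nlinarith
    have h4 : dist (γ₁ t) (γ₂ t) ^ 2 ≤ 0 := by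
      by_contra! hcon
      nlinarith
    exact pow_eq_zero_iff two_ne_zero |>.1 (le_antisymm h4 (sq_nonneg _))
  · have hk : 0 < √κ := Real.sqrt_pos.2 hκ0
    have hpi := hκ hκ0
    rw [lt_div_iff₀ hk, mul_comm] at hpi
    have := hcomp.spherical hκ0 ht
    rw [hb h₁, hc h₁, mul_comm (Real.sin (√κ * t)), mul_comm (Real.cos _) (Real.sin (_ * t)),
      mul_comm (Real.sin (√κ * t)), ← Real.sin_add,
      show √κ * (dist b c - t) + √κ * t = √κ * dist b c by ring] at this
    have hs : 0 < Real.sin (√κ * dist b c) := Real.sin_pos_of_pos_of_lt_pi (by positivity) hpi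
    have hcos : 1 ≤ Real.cos (√κ * dist (γ₁ t) (γ₂ t)) := by
      by_contra! hcon
      nlinarith
    have hcos' := le_antisymm (Real.cos_le_one _) hcos
    have hle : √κ * dist (γ₁ t) (γ₂ t) ≤ √κ * dist b c := by gcongr
    have h0' : 0 ≤ √κ * dist (γ₁ t) (γ₂ t) := by positivity
    rw [Real.cos_eq_one_iff_of_lt_of_lt (by linarith [Real.pi_pos]) (by linarith [Real.pi_pos])]
      at hcos'
    exact (mul_eq_zero.1 hcos').resolve_left hk.ne'

theorem GeodesicsNotLocallyUnique.curvatureInfinite {x : Y} (h : GeodesicsNotLocallyUnique x) :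
    CurvatureInfinite x := by
  rintro κ ⟨r, hr, hcat⟩
  obtain ⟨δ, hδ, hδκ⟩ : ∃ δ > 0, 0 < κ → 2 * δ ≤ Real.pi / √κ := by
    by_cases hκ : 0 < κ
    · have := Real.pi_pos
      have := Real.sqrt_pos.2 hκ
      exact ⟨Real.pi / √κ / 2, by positivity, fun _ => by linarith⟩
    · exact ⟨1, one_pos, fun h => absurd h hκ⟩
  obtain ⟨a, ha, b, hb, γ₁, γ₂, h₁, h₂, t, ht, hne⟩ := h _
    (Metric.ball_mem_nhds x (lt_min hr hδ))
  have hsub := Metric.ball_subset_ball (x := x) (min_le_left r δ)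
  refine hne (hcat.geodesic_unique ⟨h₁.1, fun t ht => hsub (h₁.2 t ht)⟩
    ⟨h₂.1, fun t ht => hsub (h₂.2 t ht)⟩ (fun hκ => ?_) ht)
  have h3 := dist_triangle_right a b x
  have h4 := (Metric.mem_ball.1 ha).trans_le (min_le_right _ _)
  have h5 := (Metric.mem_ball.1 hb).trans_le (min_le_right _ _)
  linarith [hδκ hκ]

/-- In a space that looks like a cone near `x`, any upper curvature bound at `x` can be improved to
`0`. -/
theorem CurvatureAtMost.zero_of_dilations {x : Y} {ρ : ℝ} (hρ : 0 < ρ) (D : ℝ → Y → Y)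
    (hx : ∀ l ∈ Ioc (0 : ℝ) 1, D l x = x)
    (hD : ∀ l ∈ Ioc (0 : ℝ) 1, ∀ a ∈ Metric.ball x ρ, ∀ b ∈ Metric.ball x ρ,
      dist (D l a) (D l b) = l * dist a b)
    (h : CurvatureAtMost κ x) : CurvatureAtMost 0 x := by
  obtain ⟨r, hr, hcat⟩ := h
  obtain ⟨δ, hδ, hδκ⟩ : ∃ δ > 0, 0 < κ → 6 * δ ≤ 2 * Real.pi / √κ := by
    by_cases hκ : 0 < κ
    · have := Real.pi_pos
      have := Real.sqrt_pos.2 hκ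
      exact ⟨2 * Real.pi / √κ / 6, by positivity, fun _ => by linarith⟩
    · exact ⟨1, one_pos, fun h => absurd h hκ⟩
  -- A geodesic between points of the `R`-ball is shorter than `2 * R` and stays in the `3 *
  -- R`-ball. Triangles have perimeter below `6 * R`, which `δ` keeps within the spherical limit.
  obtain ⟨R, hR, hRr, hRρ, hRδ⟩ : ∃ R > 0, 3 * R ≤ r ∧ 3 * R ≤ ρ ∧ R ≤ δ := by
    refine ⟨min (r / 3) (min (ρ / 3) δ), by positivity, ?_, ?_, ?_⟩
    · linarith [min_le_left (r / 3) (min (ρ / 3) δ)]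
    · linarith [min_le_right (r / 3) (min (ρ / 3) δ), min_le_left (ρ / 3) δ]
    · linarith [min_le_right (r / 3) (min (ρ / 3) δ), min_le_right (ρ / 3) δ]
  have hdiam : ∀ a ∈ Metric.ball x R, ∀ b ∈ Metric.ball x R, dist a b < 2 * R := by
    intro a ha b hb
    have := dist_triangle_right a b x
    rw [Metric.mem_ball] at ha hb
    linarith
  have hsub : Metric.ball x R ⊆ Metric.ball x r := Metric.ball_subset_ball (by linarith)
  refine ⟨R, hR, isCAT_zero_ball hsub ?_ ?_⟩
  · intro a ha b hb
    refine hcat.1 a (hsub ha) b (hsub hb) fun hκ => ?_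
    have := hδκ hκ
    have := hdiam a ha b hb
    rw [mul_div_assoc] at *
    linarith
  intro a ha b hb c hc γ hγ t ht
  have hx3 : x ∈ Metric.ball x (3 * R) := Metric.mem_ball_self (by linarith)
  have hball3 : Metric.ball x R ⊆ Metric.ball x (3 * R) := Metric.ball_subset_ball (by linarith)
  have hballρ : Metric.ball x (3 * R) ⊆ Metric.ball x ρ := Metric.ball_subset_ball hRρ
  have hγ3 : ∀ τ ∈ Icc 0 (dist b c), γ τ ∈ Metric.ball x (3 * R) := by
    intro τ hτ
    have h1 := hγ.1.2.2 τ hτ 0 ⟨le_rfl, dist_nonneg⟩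
    rw [hγ.1.1, sub_zero, abs_of_nonneg hτ.1] at h1
    have h2 := dist_triangle (γ τ) b x
    have h3 := hdiam b hb c hc
    have h4 := hτ.2
    rw [Metric.mem_ball] at hb ⊢
    linarith
  have hDball : ∀ l ∈ Ioc (0 : ℝ) 1, ∀ y ∈ Metric.ball x (3 * R), D l y ∈ Metric.ball x r := by
    intro l hl y hy
    have := hD l hl y (hballρ hy) x (hballρ hx3)
    rw [hx l hl] at this
    rw [Metric.mem_ball, this]
    rw [Metric.mem_ball] at hy
    nlinarith [hl.1, hl.2, dist_nonneg (x := y) (y := x)]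
  -- the comparison inequality for the dilated triangle
  have key : ∀ l ∈ Ioc (0 : ℝ) 1, ComparisonInequality κ (D l a) (D l b) (D l c)
      fun τ => D l (γ (τ / l)) := by
    intro l hl
    have hbc := hD l hl b (hballρ (hball3 hb)) c (hballρ (hball3 hc))
    have hscale : ∀ τ ∈ Icc 0 (dist (D l b) (D l c)), τ / l ∈ Icc 0 (dist b c) := by
      intro τ hτ
      rw [hbc] at hτ
      exact ⟨div_nonneg hτ.1 hl.1.le, by rw [div_le_iff₀ hl.1, mul_comm]; exact hτ.2⟩
    refine hcat.2 _ (hDball l hl a (hball3 ha)) _ (hDball l hl b (hball3 hb)) _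
      (hDball l hl c (hball3 hc)) _ ⟨⟨?_, ?_, ?_⟩, ?_⟩ fun hκ => ?_
    · simp only [zero_div, hγ.1.1]
    · simp only [hbc]
      rw [mul_div_cancel_left₀ _ hl.1.ne', hγ.1.2.1]
    · intro τ hτ τ' hτ'
      simp only
      rw [hD l hl _ (hballρ (hγ3 _ (hscale τ hτ))) _ (hballρ (hγ3 _ (hscale τ' hτ'))),
        hγ.1.2.2 _ (hscale τ hτ) _ (hscale τ' hτ'), ← sub_div, abs_div, abs_of_pos hl.1]
      field_simp [hl.1.ne']
    · exact fun τ hτ => hDball l hl _ (hγ3 _ (hscale τ hτ))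
    · rw [hbc, hD l hl a (hballρ (hball3 ha)) b (hballρ (hball3 hb)),
        hD l hl c (hballρ (hball3 hc)) a (hballρ (hball3 ha))]
      have h1 := hdiam a ha b hb
      have h2 := hdiam b hb c hc
      have h3 := hdiam c hc a ha
      have h4 := hδκ hκ
      have h5 : l * (dist a b + dist b c + dist c a) ≤ dist a b + dist b c + dist c a :=
        mul_le_of_le_one_left (by positivity) hl.2
      linarith
  have hdist : ∀ l ∈ Ioc (0 : ℝ) 1, dist (D l b) (D l c) = l * dist b c ∧
      dist (D l a) (D l b) = l * dist a b ∧ dist (D l a) (D l c) = l * dist a c ∧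
      dist (D l a) (D l (γ (l * t / l))) = l * dist a (γ t) := by
    intro l hl
    rw [mul_div_cancel_left₀ _ hl.1.ne']
    exact ⟨hD l hl _ (hballρ (hball3 hb)) _ (hballρ (hball3 hc)),
      hD l hl _ (hballρ (hball3 ha)) _ (hballρ (hball3 hb)),
      hD l hl _ (hballρ (hball3 ha)) _ (hballρ (hball3 hc)),
      hD l hl _ (hballρ (hball3 ha)) _ (hballρ (hγ3 t ht))⟩
  have hmem : ∀ l ∈ Ioc (0 : ℝ) 1, l * t ∈ Icc 0 (dist (D l b) (D l c)) := by
    intro l hl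
    rw [(hdist l hl).1]
    exact ⟨mul_nonneg hl.1.le ht.1, mul_le_mul_of_nonneg_left ht.2 hl.1.le⟩
  have hsmall : ∀ k : ℝ, 0 < k → ∀ᶠ s : ℝ in 𝓝[>] 0, ∃ l ∈ Ioc (0 : ℝ) 1, k * l = s := by
    intro k hk
    filter_upwards [Ioc_mem_nhdsGT hk] with s hs
    exact ⟨s / k, ⟨div_pos hs.1 hk, (div_le_one hk).2 hs.2⟩, by field_simp⟩
  obtain hκ0 | rfl | hκ0 := lt_trichotomy κ 0
  · refine stewart_of_eventually_hyperbolic ?_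
    filter_upwards [hsmall _ (Real.sqrt_pos.2 (by linarith : 0 < -κ))]
    rintro s ⟨l, hl, rfl⟩
    have := (key l hl).hyperbolic hκ0 (hmem l hl)
    obtain ⟨e1, e2, e3, e4⟩ := hdist l hl
    rw [e1, e2, e3, e4, ← mul_sub] at this
    simpa only [mul_assoc] using this
  · have := (key 1 ⟨one_pos, le_rfl⟩).stewartInequality _ (hmem 1 ⟨one_pos, le_rfl⟩)
    obtain ⟨e1, e2, e3, e4⟩ := hdist 1 ⟨one_pos, le_rfl⟩
    rw [e1, e2, e3, e4] at this
    simpa only [one_mul] using this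
  · refine stewart_of_eventually_sphere ?_
    filter_upwards [hsmall _ (Real.sqrt_pos.2 hκ0)]
    rintro s ⟨l, hl, rfl⟩
    have := (key l hl).spherical hκ0 (hmem l hl)
    obtain ⟨e1, e2, e3, e4⟩ := hdist l hl
    rw [e1, e2, e3, e4, ← mul_sub] at this
    simpa only [mul_assoc] using this

end Comparison


/-! ### Identifications of pre-shapes -/

section Shapes

variable {T : BinaryTree} {F : TopologyFamily T} {A : Type} [NormedAddCommGroup A]
  {p : ℝ≥0∞}

/-- The set of edges with nonzero attribute. -/
def supp (x : PreShape T A p) : Set T.Edge := {e | x e ≠ 0}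

theorem mem_supp {x : PreShape T A p} {e : T.Edge} : e ∈ supp x ↔ x e ≠ 0 := Iff.rfl

theorem mem_restrictedPreShapes {x : PreShape T A p} :
    x ∈ restrictedPreShapes F A p ↔ ∃ S ∈ F.carrier, supp x ⊆ S := by
  simp only [restrictedPreShapes, mem_iUnion, mem_ofPred_eq, exists_prop]
  refine exists_congr fun S => and_congr_right fun _ => forall_congr' fun e => ?_
  rw [mem_supp]
  tauto

theorem mem_restrictedPreShapes_of_supp_subset {x y : PreShape T A p}
    (hy : y ∈ restrictedPreShapes F A p) (h : supp x ⊆ supp y) : x ∈ restrictedPreShapes F A p := by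
  rw [mem_restrictedPreShapes] at *
  obtain ⟨S, hS, hyS⟩ := hy
  exact ⟨S, hS, h.trans hyS⟩

theorem supp_add_smul_sub_subset [NormedSpace ℝ A] {x y : PreShape T A p} (h : supp x ⊆ supp y)
    (l : ℝ) : supp (x + l • (y - x)) ⊆ supp y := by
  intro e he
  by_contra hy
  have hx : e ∉ supp x := fun hx => hy (h hx)
  simp only [mem_supp, not_not] at hx hy
  simp [mem_supp, hx, hy] at he

theorem SameShape.ncard_supp {x y : PreShape T A p} (h : SameShape x y) :
    (supp x).ncard = (supp y).ncard := by
  obtain ⟨φ, -, -⟩ := h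
  rw [← Nat.card_coe_set_eq, ← Nat.card_coe_set_eq]
  exact Nat.card_congr φ

/-- Depth-first order is a well-order on the finite set `S`, and a well-order has no automorphism
except the identity. This rigidity is where the order on the trees enters. -/
theorem IsOrderedTreeIso.coe_apply_eq {S S' : Set T.Edge} {φ : S ≃ S'} (hφ : IsOrderedTreeIso φ)
    (hS : S = S') (e : S) : (φ e).1 = e.1 := by
  subst hS
  have hwf : WellFoundedLT S := inferInstance
  have hmono : StrictMono φ := fun a b hab => (hφ a b).2.1 hab
  have := Subsingleton.elim (hmono.orderIsoOfSurjective φ φ.surjective) (OrderIso.refl S)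
  exact congrArg (fun f : S ≃o S => (f e).1) this

/-- A pre-shape is determined by its tree-shape and the set of its non-collapsed edges. -/
theorem SameShape.eq_of_supp_eq {x y : PreShape T A p} (h : SameShape x y) (hs : supp x = supp y) :
    x = y := by
  obtain ⟨φ, hφ, hxy⟩ := h
  refine PiLp.ext fun e => ?_
  by_cases he : e ∈ supp x
  · rw [← hxy ⟨e, he⟩, hφ.coe_apply_eq hs]
  · have he' : e ∉ supp y := hs ▸ he
    rw [mem_supp, not_not] at he he'
    rw [he, he']

/-- An isomorphism of topologies induces an isometry that carries along the attributes. -/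
theorem IsOrderedTreeIso.exists_isometry [NormedSpace ℝ A] [Fact (1 ≤ p)] {S S' : Set T.Edge}
    {φ : S ≃ S'} (hφ : IsOrderedTreeIso φ) : ∃ τ : PreShape T A p ≃ₗᵢ[ℝ] PreShape T A p,
      (∀ u (e : S), τ u (φ e).1 = u e.1) ∧
        ∀ u, supp u ⊆ S → SameShape u (τ u) ∧ supp (τ u) ⊆ S' := by
  classical
  -- Off `S` the extension is arbitrary and ignores the tree structure, so the shape is preserved
  -- only for supports inside `S`.
  let σ : Equiv.Perm T.Edge := Equiv.extendSubtype (p := (· ∈ S)) (q := (· ∈ S')) φ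
  have hσ : ∀ e (he : e ∈ S), σ e = (φ ⟨e, he⟩).1 := fun e he =>
    Equiv.extendSubtype_apply_of_mem (p := (· ∈ S)) (q := (· ∈ S')) φ e he
  let τ := LinearIsometryEquiv.piLpCongrLeft p ℝ A σ
  have hτ : ∀ u e, τ u (σ e) = u e := by
    intro u e
    simp [τ, LinearIsometryEquiv.piLpCongrLeft_apply, Equiv.piCongrLeft']
  refine ⟨τ, fun u e => by rw [← hσ e.1 e.2, hτ],
    fun u hu => ⟨⟨σ.subtypeEquiv fun e => by simp [hτ], fun e f => ?_, fun e => hτ u e.1⟩, ?_⟩⟩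
  · have he := hσ e.1 (hu e.2)
    have hf := hσ f.1 (hu f.2)
    simp only [Equiv.subtypeEquiv_apply, he, hf]
    exact hφ ⟨e.1, hu e.2⟩ ⟨f.1, hu f.2⟩
  · intro e he
    obtain ⟨f, rfl⟩ := σ.surjective e
    rw [mem_supp, hτ] at he
    rw [hσ f (hu he)]
    exact (φ _).2

/-- An identification of pre-shapes extends to an isometry that carries along all degenerations. -/
theorem SameShape.exists_isometry [NormedSpace ℝ A] [Fact (1 ≤ p)] {y y' : PreShape T A p}
    (h : SameShape y y') : ∃ τ : PreShape T A p ≃ₗᵢ[ℝ] PreShape T A p, τ y = y' ∧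
      ∀ u, supp u ⊆ supp y → SameShape u (τ u) ∧ supp (τ u) ⊆ supp y' := by
  obtain ⟨φ, hφ, hyy'⟩ := h
  obtain ⟨τ, hτ, hτ'⟩ := hφ.exists_isometry (A := A) (p := p)
  refine ⟨τ, PiLp.ext fun e => ?_, hτ'⟩
  by_cases he : e ∈ supp y'
  · obtain ⟨f, hf⟩ := φ.surjective ⟨e, he⟩
    have h1 := hτ y f
    have h2 := hyy' f
    rw [hf] at h1 h2
    rw [h1, ← h2]
  · have h1 : e ∉ supp (τ y) := fun h1 => he ((hτ' y subset_rfl).2 h1)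
    rw [mem_supp, not_not] at he h1
    rw [he, h1]

end Shapes

/-! ### The local structure of the quotient -/

section Local

variable {T : BinaryTree} {F : TopologyFamily T} {A : Type} [NormedAddCommGroup A]
  [NormedSpace ℝ A] {p : ℝ≥0∞} [Fact (1 ≤ p)]

theorem dist_le_of_isChain {a b : RestrictedShapeSpace F A p} {L : ℝ} (h : IsChain a b L) :
    dist a b ≤ L :=
  csInf_le (bddBelow_isChain a b) h

theorem exists_isChain_lt {a b : RestrictedShapeSpace F A p} {L : ℝ} (h : dist a b < L) :
    ∃ L' < L, IsChain a b L' := by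
  obtain ⟨L', h1, h2⟩ := exists_lt_of_csInf_lt (exists_isChain a b) h
  exact ⟨L', h2, h1⟩

theorem segment_subset_of_supp_subset {S : Set T.Edge} (hS : S ∈ F.carrier) {x y : PreShape T A p}
    (hx : supp x ⊆ S) (hy : supp y ⊆ S) : segment ℝ x y ⊆ restrictedPreShapes F A p := by
  rintro z ⟨s, t, -, -, -, rfl⟩
  refine mem_restrictedPreShapes.2 ⟨S, hS, fun e he => ?_⟩
  by_contra h
  have hx' : e ∉ supp x := fun h' => h (hx h')
  have hy' : e ∉ supp y := fun h' => h (hy h')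
  simp only [mem_supp, not_not] at hx' hy'
  simp [mem_supp, hx', hy'] at he

/-- `ρ` separates the representatives of the tree-shape of `x`, and at distance less than `ρ` from a
representative no edge of it is collapsed. -/
structure Separates (x : PreShape T A p) (ρ : ℝ) : Prop where
  pos : 0 < ρ
  eq_of_dist_lt : ∀ x₁ x₂, SameShape x x₁ → SameShape x x₂ → dist x₁ x₂ < 2 * ρ → x₁ = x₂
  supp_subset : ∀ x', SameShape x x' → ∀ y, dist y x' < ρ → supp x' ⊆ supp y

/-- There are finitely many representatives, and nonvanishing of an attribute is an open condition.
The factor `2` in the separation makes two representatives within `ρ` of a common point equal. -/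
theorem exists_separates (x : PreShape T A p) : ∃ ρ, Separates x ρ := by
  have h1 : ∀ᶠ ρ : ℝ in 𝓝[>] 0, ∀ x₁ ∈ {x' | SameShape x x'}, ∀ x₂ ∈ {x' | SameShape x x'},
      dist x₁ x₂ < 2 * ρ → x₁ = x₂ := by
    refine (eventually_all_finite (finite_sameShape x)).2 fun x₁ _ =>
      (eventually_all_finite (finite_sameShape x)).2 fun x₂ _ => ?_
    by_cases h : x₁ = x₂
    · exact Eventually.of_forall fun _ _ => h
    · have : 0 < dist x₁ x₂ / 2 := half_pos (dist_pos.2 h)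
      filter_upwards [Ioc_mem_nhdsGT this] with ρ hρ hlt
      linarith [hρ.2]
  have h2 : ∀ᶠ ρ : ℝ in 𝓝[>] 0, ∀ x' ∈ {x' | SameShape x x'}, ∀ y, dist y x' < ρ →
      supp x' ⊆ supp y := by
    refine (eventually_all_finite (finite_sameShape x)).2 fun x' _ => ?_
    have : ∀ᶠ y in 𝓝 x', ∀ e, x' e ≠ 0 → y e ≠ 0 := by
      refine eventually_all.2 fun e => ?_
      by_cases he : x' e = 0
      · exact Eventually.of_forall fun _ h => absurd he h
      · have hc : Continuous fun y : PreShape T A p => y e := by fun_prop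
        filter_upwards [hc.continuousAt.eventually_ne he] with y hy _ using hy
    obtain ⟨ε, hε, h⟩ := Metric.eventually_nhds_iff.1 this
    filter_upwards [Ioc_mem_nhdsGT hε] with ρ hρ y hy e he
    exact h (hy.trans_le hρ.2) e he
  obtain ⟨ρ, ⟨h1, h2⟩, hρ⟩ := ((h1.and h2).and self_mem_nhdsWithin).exists
  exact ⟨ρ, hρ, fun x₁ x₂ h h' => h1 x₁ h x₂ h', h2⟩

/-- The isometry taking `y` to `u` identifies all degenerations of `y`. Since `supp x' ⊆ supp y`,
both `x'` and the whole line through `x'` and `y` consist of such degenerations. -/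
theorem Separates.exists_transport {x : PreShape T A p} {ρ : ℝ} (hρ : Separates x ρ)
    {x' y u : PreShape T A p} (hx' : SameShape x x') (hy : dist y x' < ρ) (hyu : SameShape y u) :
    ∃ x₁, SameShape x x₁ ∧ dist u x₁ = dist y x' ∧
      ∀ l : ℝ, SameShape (x' + l • (y - x')) (x₁ + l • (u - x₁)) := by
  obtain ⟨τ, rfl, hτ⟩ := hyu.exists_isometry
  have hsupp := hρ.supp_subset x' hx' y hy
  refine ⟨τ x', hx'.trans (hτ x' hsupp).1, τ.dist_map _ _, fun l => ?_⟩
  have := (hτ _ (supp_add_smul_sub_subset hsupp l)).1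
  simpa using this

/-- `a'` arises from `a` by dilating by the factor `l` around a representative of the tree-shape of
`x` that is closer than `ρ`. -/
def IsDilation (x : PreShape T A p) (ρ l : ℝ) (a a' : RestrictedShapeSpace F A p) : Prop :=
  ∃ (y w : restrictedPreShapes F A p) (x' : PreShape T A p), shape y = a ∧ shape w = a' ∧
    SameShape x x' ∧ dist y.1 x' < ρ ∧ w.1 = x' + l • (y.1 - x')

variable {x : PreShape T A p} {ρ : ℝ}

/-- Transport moves the centre used for `y` to a representative within `ρ` of `u`, and by separation
that is the centre used for `u`. -/
theorem IsDilation.unique (hρ : Separates x ρ) {l : ℝ} {a a₁ a₂ : RestrictedShapeSpace F A p}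
    (h₁ : IsDilation x ρ l a a₁) (h₂ : IsDilation x ρ l a a₂) : a₁ = a₂ := by
  obtain ⟨y, w, x', rfl, rfl, hx', hy, hw⟩ := h₁
  obtain ⟨u, v, x'', hyu, rfl, hx'', hu, hv⟩ := h₂
  obtain ⟨x₁, hx₁, hux₁, hl⟩ := hρ.exists_transport hx' hy (shape_eq_iff.1 hyu.symm)
  have : x₁ = x'' := hρ.eq_of_dist_lt _ _ hx₁ hx'' (by
    linarith [dist_triangle_left x₁ x'' u.1])
  rw [shape_eq_iff, hw, hv, ← this]
  exact hl l

theorem Separates.exists_isDilation (hρ : Separates x ρ) (l : ℝ) (y : restrictedPreShapes F A p)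
    {x' : PreShape T A p} (hx' : SameShape x x') (hy : dist y.1 x' < ρ) :
    ∃ w : restrictedPreShapes F A p, w.1 = x' + l • (y.1 - x') ∧
      IsDilation x ρ l (shape y) (shape w) :=
  ⟨⟨_, mem_restrictedPreShapes_of_supp_subset y.2
    (supp_add_smul_sub_subset (hρ.supp_subset x' hx' y.1 hy) l)⟩, rfl,
    y, _, x', rfl, rfl, hx', hy, rfl⟩

/-- `Z` need not be convex, but it is closed under shrinking supports, and each point of the dilated
segment degenerates the corresponding point of the original one. -/
theorem Separates.segment_subset (hρ : Separates x ρ) {l : ℝ} {u v x' : PreShape T A p}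
    (hx' : SameShape x x') (hu : dist u x' < ρ) (hv : dist v x' < ρ)
    (huv : segment ℝ u v ⊆ restrictedPreShapes F A p) :
    segment ℝ (x' + l • (u - x')) (x' + l • (v - x')) ⊆ restrictedPreShapes F A p := by
  rintro z ⟨s, t, hs, ht, hst, rfl⟩
  have hq : s • u + t • v ∈ segment ℝ u v := ⟨s, t, hs, ht, hst, rfl⟩
  have hball := (convex_ball x' ρ).segment_subset (Metric.mem_ball.2 hu) (Metric.mem_ball.2 hv) hq
  refine mem_restrictedPreShapes_of_supp_subset (huv hq) ?_
  have := supp_add_smul_sub_subset (hρ.supp_subset x' hx' _ hball) l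
  convert this using 2
  obtain rfl : s = 1 - t := by linarith
  module

/-- Short chains near `x` can be dilated. -/
theorem IsChain.dilate (hρ : Separates x ρ) {l : ℝ} (hl : 0 ≤ l)
    {a b : RestrictedShapeSpace F A p} {L : ℝ} (h : IsChain a b L) :
    ∀ (y : restrictedPreShapes F A p) (x' : PreShape T A p), shape y = a → SameShape x x' →
      dist y.1 x' + L < ρ → ∃ a' b', IsDilation x ρ l a a' ∧ IsDilation x ρ l b b' ∧
        IsChain a' b' (l * L) ∧ ∃ (z : restrictedPreShapes F A p) (x'' : PreShape T A p),
          shape z = b ∧ SameShape x x'' ∧ dist z.1 x'' ≤ dist y.1 x' + L := by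
  have hd : ∀ x₁ u v : PreShape T A p,
      dist (x₁ + l • (u - x₁)) (x₁ + l • (v - x₁)) = l * dist u v := by
    intro x₁ u v
    rw [dist_add_left, dist_smul₀, Real.norm_of_nonneg hl, dist_sub_right]
  induction h with
  | single u v huv =>
    intro y x' hy hx' hlt
    have h0 := dist_nonneg (x := u.1) (y := v.1)
    obtain ⟨x₁, hx₁, hux₁, -⟩ := hρ.exists_transport hx' (by linarith) (shape_eq_iff.1 hy)
    have hv := dist_triangle_left v.1 x₁ u.1
    obtain ⟨w, hw, hwd⟩ := hρ.exists_isDilation l u hx₁ (by linarith)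
    obtain ⟨w', hw', hwd'⟩ := hρ.exists_isDilation l v hx₁ (by linarith)
    refine ⟨_, _, hwd, hwd', ?_, v, x₁, rfl, hx₁, by linarith⟩
    rw [← hd x₁, ← hw, ← hw']
    refine IsChain.single w w' ?_
    rw [hw, hw']
    exact hρ.segment_subset hx₁ (by linarith) (by linarith) huv
  | cons u v b L huv hL ih =>
    intro y x' hy hx' hlt
    have h0 := dist_nonneg (x := u.1) (y := v.1)
    have hL0 := hL.nonneg
    obtain ⟨x₁, hx₁, hux₁, -⟩ := hρ.exists_transport hx' (by linarith) (shape_eq_iff.1 hy)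
    have hv := dist_triangle_left v.1 x₁ u.1
    obtain ⟨w, hw, hwd⟩ := hρ.exists_isDilation l u hx₁ (by linarith)
    obtain ⟨w', hw', hwd'⟩ := hρ.exists_isDilation l v hx₁ (by linarith)
    obtain ⟨a', b', ha', hb', hchain, z, x'', hz, hx'', hzx⟩ := ih v x₁ rfl hx₁ (by linarith)
    -- The breakpoint is dilated once with the first segment and once with the rest; both give the
    -- same shape, so the dilated pieces fit together.
    obtain rfl := ha'.unique hρ hwd'
    refine ⟨_, b', hwd, hb', ?_, z, x'', hz, hx'', by linarith⟩
    rw [mul_add, ← hd x₁, ← hw, ← hw']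
    refine IsChain.cons w w' b' _ ?_ hchain
    rw [hw, hw']
    exact hρ.segment_subset hx₁ (by linarith) (by linarith) huv

theorem Separates.exists_near {x : restrictedPreShapes F A p} (hρ : Separates x.1 ρ) {r : ℝ}
    (hr : r ≤ ρ) {a : RestrictedShapeSpace F A p} (ha : a ∈ Metric.ball (shape x) r) :
    ∃ (y : restrictedPreShapes F A p) (x' : PreShape T A p), shape y = a ∧ SameShape x.1 x' ∧
      dist y.1 x' < r := by
  obtain ⟨L, hL, hchain⟩ := exists_isChain_lt (Metric.mem_ball'.1 ha)
  obtain ⟨-, -, -, -, -, z, x'', hz, hx'', hd⟩ := hchain.dilate hρ zero_le_one x x.1 rfl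
    (SameShape.refl _) (by rw [dist_self]; linarith)
  rw [dist_self] at hd
  exact ⟨z, x'', hz, hx'', by linarith⟩

theorem IsDilation.dist_le (hρ : Separates x ρ) {l : ℝ} (hl : 0 < l)
    {a a' b b' : RestrictedShapeSpace F A p} (ha : IsDilation x ρ l a a')
    (hb : IsDilation x ρ l b b') {y : restrictedPreShapes F A p} {x' : PreShape T A p}
    (hy : shape y = a) (hx' : SameShape x x') (hlt : dist y.1 x' + dist a b < ρ) :
    dist a' b' ≤ l * dist a b := by
  by_contra! hcon
  rw [← lt_div_iff₀' hl] at hcon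
  obtain ⟨L, hL, hchain⟩ := exists_isChain_lt (lt_min hcon (lt_sub_iff_add_lt'.2 hlt))
  rw [lt_min_iff, lt_div_iff₀' hl] at hL
  obtain ⟨a'', b'', ha'', hb'', hchain', -⟩ := hchain.dilate hρ hl.le y x' hy hx' (by linarith)
  obtain rfl := ha''.unique hρ ha
  obtain rfl := hb''.unique hρ hb
  linarith [dist_le_of_isChain hchain']

/-- An upper curvature bound at a tree-shape can be improved to `0`. -/
theorem curvatureAtMost_zero_of_curvatureAtMost {κ : ℝ} {a : RestrictedShapeSpace F A p}
    (h : CurvatureAtMost κ a) : CurvatureAtMost 0 a := by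
  classical
  obtain ⟨x, rfl⟩ := exists_shape a
  obtain ⟨ρ, hρ⟩ := exists_separates x.1
  have hρ0 := hρ.pos
  -- With radius `ρ / 4` a point is within `ρ / 4` of its centre and distances are below `ρ / 2`, so
  -- nearly optimal chains remain where dilation is defined.
  have hex : ∀ l : ℝ, ∀ a ∈ Metric.ball (shape x) (ρ / 4), ∃ a', IsDilation x.1 ρ l a a' := by
    intro l a ha
    obtain ⟨y, x', rfl, hx', hy⟩ := hρ.exists_near (by linarith) ha
    obtain ⟨w, -, hw⟩ := hρ.exists_isDilation l y hx' (by linarith)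
    exact ⟨_, hw⟩
  obtain ⟨D, hD⟩ : ∃ D : ℝ → RestrictedShapeSpace F A p → RestrictedShapeSpace F A p,
      ∀ l, ∀ a ∈ Metric.ball (shape x) (ρ / 4), IsDilation x.1 ρ l a (D l a) := by
    refine ⟨fun l a => if h : ∃ a', IsDilation x.1 ρ l a a' then h.choose else a, fun l a ha => ?_⟩
    have := hex l a ha
    simp only [dif_pos this]
    exact this.choose_spec
  refine h.zero_of_dilations (ρ := ρ / 4) (by linarith) D (fun l hl => ?_) fun l hl a ha b hb => ?_
  · refine (hD l _ (Metric.mem_ball_self (by linarith))).unique hρ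
      ⟨x, x, x.1, rfl, rfl, SameShape.refl _, ?_, ?_⟩
    · rwa [dist_self]
    · simp
  · obtain ⟨y, x', rfl, hx', hy⟩ := hρ.exists_near (by linarith) ha
    obtain ⟨z, x'', rfl, hx'', hz⟩ := hρ.exists_near (by linarith) hb
    have hyz := dist_triangle_right (shape y) (shape z) (shape x)
    rw [Metric.mem_ball] at ha hb
    have hle := (hD l _ ha).dist_le hρ hl.1 (hD l _ hb) rfl hx' (by linarith)
    obtain ⟨w, hw, hwd⟩ := hρ.exists_isDilation l y hx' (by linarith)
    obtain ⟨v, hv, hvd⟩ := hρ.exists_isDilation l z hx'' (by linarith)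
    have hinv : ∀ (y w : restrictedPreShapes F A p) (x' : PreShape T A p), SameShape x.1 x' →
        dist y.1 x' < ρ / 4 → w.1 = x' + l • (y.1 - x') →
        dist w.1 x' ≤ ρ / 4 ∧ IsDilation x.1 ρ l⁻¹ (shape w) (shape y) := by
      intro y w x' hx' hy hw
      have h1 : dist w.1 x' ≤ ρ / 4 := by
        rw [hw, dist_eq_norm, add_sub_cancel_left, norm_smul, Real.norm_of_nonneg hl.1.le,
          ← dist_eq_norm]
        nlinarith [hl.1, hl.2, dist_nonneg (x := y.1) (y := x')]
      refine ⟨h1, w, y, x', rfl, rfl, hx', by linarith, ?_⟩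
      rw [hw, add_sub_cancel_left, smul_smul, inv_mul_cancel₀ hl.1.ne', one_smul,
        add_sub_cancel]
    rw [(hD l _ ha).unique hρ hwd, (hD l _ hb).unique hρ hvd] at *
    have hsmall : l * dist (shape y) (shape z) ≤ dist (shape y) (shape z) :=
      mul_le_of_le_one_left dist_nonneg hl.2
    obtain ⟨hwx, hwi⟩ := hinv y w x' hx' hy hw
    obtain ⟨-, hvi⟩ := hinv z v x'' hx'' hz hv
    -- The upper bound for the inverse dilation is the missing lower bound.
    have hge := hwi.dist_le hρ (inv_pos.2 hl.1) hvi rfl hx' (by linarith)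
    rw [← div_eq_inv_mul, le_div_iff₀ hl.1] at hge
    linarith

end Local


/-! ### Tree-shapes of maximal topology -/

section Maximal

variable {T : BinaryTree} {F : TopologyFamily T} {A : Type} [NormedAddCommGroup A]
  [NormedSpace ℝ A] {p : ℝ≥0∞} [Fact (1 ≤ p)]

/-- The topology of `x` does not arise from another topology of the family by collapsing edges. -/
def IsMaximal (F : TopologyFamily T) (x : PreShape T A p) : Prop :=
  ∀ x', SameShape x x' → ∀ S ∈ F.carrier, supp x' ⊆ S → S ⊆ supp x'

theorem IsMaximal.supp_eq {x x' y : PreShape T A p} (hx : IsMaximal F x) (hx' : SameShape x x')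
    (hy : y ∈ restrictedPreShapes F A p) (h : supp x' ⊆ supp y) : supp y = supp x' := by
  obtain ⟨S, hS, hyS⟩ := mem_restrictedPreShapes.1 hy
  exact (hyS.trans (hx x' hx' S hS (h.trans hyS))).antisymm h

/-- Near a tree-shape of maximal topology, short chains can be followed in the pre-shape space. -/
theorem IsChain.follow {x : PreShape T A p} {ρ : ℝ} (hρ : Separates x ρ) (hx : IsMaximal F x)
    {a b : RestrictedShapeSpace F A p} {L : ℝ} (h : IsChain a b L) :
    ∀ y : restrictedPreShapes F A p, shape y = a → dist y.1 x + L < ρ →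
      ∃ u : restrictedPreShapes F A p, shape u = b ∧ dist y.1 u.1 ≤ L := by
  -- By maximality `u` and `v` have the same support, so the isometry taking `u` to its other
  -- representative `y` is also an identification at `v`.
  have step : ∀ u v y : restrictedPreShapes F A p, shape y = shape u →
      dist y.1 x + dist u.1 v.1 < ρ →
      ∃ z : restrictedPreShapes F A p, shape z = shape v ∧ dist y.1 z.1 = dist u.1 v.1 := by
    intro u v y hyu hlt
    have h0 := dist_nonneg (x := u.1) (y := v.1)
    obtain ⟨x₁, hx₁, hux₁, -⟩ := hρ.exists_transport (SameShape.refl x) (by linarith)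
      (shape_eq_iff.1 hyu)
    have hv := dist_triangle_left v.1 x₁ u.1
    have hsu := hx.supp_eq hx₁ u.2 (hρ.supp_subset x₁ hx₁ u.1 (by linarith))
    have hsv := hx.supp_eq hx₁ v.2 (hρ.supp_subset x₁ hx₁ v.1 (by linarith))
    obtain ⟨τ, hτ, hτ'⟩ := (shape_eq_iff.1 hyu.symm).exists_isometry
    obtain ⟨h1, h2⟩ := hτ' v.1 (hsv.trans hsu.symm).subset
    refine ⟨⟨τ v.1, mem_restrictedPreShapes_of_supp_subset y.2 h2⟩, ?_, ?_⟩
    · exact (shape_eq_iff.2 h1).symm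
    · exact (congrArg (dist · (τ v.1)) hτ).symm.trans (τ.dist_map _ _)
  induction h with
  | single u v huv =>
    intro y hy hlt
    obtain ⟨z, hz, hd⟩ := step u v y hy hlt
    exact ⟨z, hz, hd.le⟩
  | cons u v b L huv hL ih =>
    intro y hy hlt
    have hL0 := hL.nonneg
    obtain ⟨z, hz, hd⟩ := step u v y hy (by linarith)
    have h1 := dist_triangle_left z.1 x y.1
    obtain ⟨w, hw, hzw⟩ := ih z hz (by linarith)
    exact ⟨w, hw, by linarith [dist_triangle y.1 z.1 w.1]⟩

theorem dist_shape_le {x y : restrictedPreShapes F A p}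
    (h : segment ℝ x.1 y.1 ⊆ restrictedPreShapes F A p) : dist (shape x) (shape y) ≤ dist x.1 y.1 :=
  dist_le_of_isChain (IsChain.single x y h)

/-- Near a tree-shape of maximal topology the quotient is isometric to the coordinate subspace. -/
theorem IsMaximal.exists_chart {x : restrictedPreShapes F A p} (hx : IsMaximal F x.1) :
    ∃ R > 0, (∀ a ∈ Metric.ball (shape x) R,
        ∃ u : restrictedPreShapes F A p, shape u = a ∧ dist u.1 x.1 < R) ∧
      ∀ u v : restrictedPreShapes F A p, dist u.1 x.1 < R → dist v.1 x.1 < R →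
        supp u.1 = supp x.1 ∧ dist (shape u) (shape v) = dist u.1 v.1 := by
  obtain ⟨ρ, hρ⟩ := exists_separates x.1
  have hρ0 := hρ.pos
  refine ⟨ρ / 4, by linarith, fun a ha => ?_, fun u v hu hv => ?_⟩
  · obtain ⟨L, hL, hchain⟩ := exists_isChain_lt (Metric.mem_ball'.1 ha)
    obtain ⟨u, hu, hd⟩ := hchain.follow hρ hx x rfl (by rw [dist_self]; linarith)
    exact ⟨u, hu, by rw [dist_comm]; linarith⟩
  · have hsupp : ∀ u : restrictedPreShapes F A p, dist u.1 x.1 < ρ → supp u.1 = supp x.1 :=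
      fun u hu => hx.supp_eq (SameShape.refl _) u.2
        (hρ.supp_subset x.1 (SameShape.refl _) u.1 hu)
    have hsu := hsupp u (by linarith)
    have hsv := hsupp v (by linarith)
    obtain ⟨S, hS, hxS⟩ := mem_restrictedPreShapes.1 x.2
    have hle := dist_shape_le (x := u) (y := v) (segment_subset_of_supp_subset hS
      (hsu.subset.trans hxS) (hsv.subset.trans hxS))
    refine ⟨hsu, hle.antisymm ?_⟩
    have huv := dist_triangle_right u.1 v.1 x.1
    by_contra! hcon
    obtain ⟨L, hL, hchain⟩ := exists_isChain_lt hcon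
    obtain ⟨z, hz, hd⟩ := hchain.follow hρ hx u rfl (by linarith)
    have hzx := dist_triangle_left z.1 x.1 u.1
    -- The chain followed from `u` ends at a representative of the shape of `v` with the same
    -- support as `v`, hence at `v` itself.
    have := (shape_eq_iff.1 hz).eq_of_supp_eq ((hsupp z (by linarith)).trans hsv.symm)
    rw [this] at hd
    linarith

theorem exists_supp_eq [Nontrivial A] (x : PreShape T A p) {S : Set T.Edge} (hS : supp x ⊆ S)
    {ε : ℝ} (hε : 0 < ε) : ∃ y : PreShape T A p, supp y = S ∧ dist x y < ε := by
  classical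
  obtain ⟨v, hv⟩ := exists_ne (0 : A)
  let g : PreShape T A p := WithLp.toLp p fun e => if e ∈ S \ supp x then v else 0
  have hc : Continuous fun s : ℝ => x + s • g := by fun_prop
  have h0 : Tendsto (fun s : ℝ => x + s • g) (𝓝[>] 0) (𝓝 x) := by
    simpa using (hc.tendsto 0).mono_left nhdsWithin_le_nhds
  obtain ⟨s, hs, hs0⟩ := ((h0.eventually (Metric.ball_mem_nhds x hε)).and
    self_mem_nhdsWithin).exists
  have hs0 : s ≠ 0 := (mem_Ioi.1 hs0).ne'
  refine ⟨x + s • g, ?_, Metric.mem_ball'.1 hs⟩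
  ext e
  have hval : (x + s • g) e = x e + s • g e := rfl
  rw [mem_supp, hval]
  by_cases hx : e ∈ supp x
  · have hg : g e = 0 := by simp [g, hx]
    rw [hg, smul_zero, add_zero]
    exact iff_of_true hx (hS hx)
  · have hx0 : x e = 0 := by simpa [mem_supp] using hx
    by_cases heS : e ∈ S <;> simp [g, hx, heS, hx0, hs0, hv]

/-- Tree-shapes of maximal topology are dense. -/
theorem exists_isMaximal [Nontrivial A] {U : Set (RestrictedShapeSpace F A p)} (hU : IsOpen U)
    {x : restrictedPreShapes F A p} (hx : shape x ∈ U) :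
    ∃ y : restrictedPreShapes F A p, IsMaximal F y.1 ∧ shape y ∈ U ∧
      (supp x.1).ncard ≤ (supp y.1).ncard := by
  have hfin : ((fun y : restrictedPreShapes F A p => (supp y.1).ncard) ''
      {y | shape y ∈ U ∧ (supp x.1).ncard ≤ (supp y.1).ncard}).Finite := by
    refine (finite_Iic (univ : Set T.Edge).ncard).subset ?_
    rintro _ ⟨y, -, rfl⟩
    exact ncard_le_ncard (subset_univ _) (toFinite _)
  -- Take the largest number of nonzero edges attained in `U`. If a representative fitted into a
  -- larger `S`, a small perturbation with support `S` would remain in `U` and exceed it.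
  obtain ⟨y, ⟨hyU, hxy⟩, hmax⟩ := Set.Finite.exists_maximalFor' _ _ hfin ⟨x, hx, le_rfl⟩
  refine ⟨y, fun y' hy' S hS hsub => ?_, hyU, hxy⟩
  have hy'Z : y' ∈ restrictedPreShapes F A p := mem_restrictedPreShapes.2 ⟨S, hS, hsub⟩
  obtain ⟨ε, hε, hball⟩ := Metric.isOpen_iff.1 hU _ hyU
  obtain ⟨z, hzS, hd⟩ := exists_supp_eq y' hsub hε
  have hzZ : z ∈ restrictedPreShapes F A p := mem_restrictedPreShapes.2 ⟨S, hS, hzS.subset⟩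
  have hyy' : shape y = shape ⟨y', hy'Z⟩ := shape_eq_iff.2 hy'
  have hle := dist_shape_le (x := (⟨y', hy'Z⟩ : restrictedPreShapes F A p)) (y := ⟨z, hzZ⟩)
    (segment_subset_of_supp_subset hS hsub hzS.subset)
  have hcard : (supp y.1).ncard ≤ S.ncard := by
    rw [hy'.ncard_supp]
    exact ncard_le_ncard hsub (toFinite _)
  have hzU : shape ⟨z, hzZ⟩ ∈ U := hball <| by
    rw [Metric.mem_ball', hyy']
    exact hle.trans_lt hd
  have := hmax (j := ⟨z, hzZ⟩) ⟨hzU, by simpa only [hzS] using hxy.trans hcard⟩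
    (by simpa only [hzS] using hcard)
  simp only [hzS, hy'.ncard_supp] at this
  exact (eq_of_subset_of_ncard_le hsub this (toFinite _)).symm.subset

end Maximal

/-! ### The QED metric -/

section QED

variable {T : BinaryTree} {F : TopologyFamily T} {A : Type} [NormedAddCommGroup A]
  [InnerProductSpace ℝ A]

/-- In the chart straight segments are geodesics, and every geodesic in the ball satisfies Stewart's
formula with equality. -/
theorem IsMaximal.curvatureAtMost_zero {x : restrictedPreShapes F A 2} (hx : IsMaximal F x.1) :
    CurvatureAtMost 0 (shape x) := by
  obtain ⟨R, hR, hball, hdist⟩ := hx.exists_chart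
  refine ⟨R, hR, isCAT_zero_ball subset_rfl ?_ ?_⟩
  · intro a ha b hb
    obtain ⟨u, rfl, hu⟩ := hball a ha
    obtain ⟨v, rfl, hv⟩ := hball b hb
    have hsu := (hdist u v hu hv).1
    have hsv := (hdist v u hv hu).1
    have huv := (hdist u v hu hv).2
    have hxR : dist x.1 x.1 < R := by rwa [dist_self]
    obtain ⟨γ, hγ⟩ : ∃ γ : ℝ → restrictedPreShapes F A 2,
        ∀ t, (γ t).1 = AffineMap.lineMap u.1 v.1 (t / dist u.1 v.1) := by
      refine ⟨fun t => ⟨AffineMap.lineMap u.1 v.1 (t / dist u.1 v.1), ?_⟩, fun t => rfl⟩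
      refine mem_restrictedPreShapes_of_supp_subset x.2 ?_
      rw [AffineMap.lineMap_apply_module', add_comm, ← hsv]
      exact supp_add_smul_sub_subset (hsu.trans hsv.symm).subset _
    have hnear : ∀ t ∈ Icc 0 (dist u.1 v.1), dist (γ t).1 x.1 < R := by
      intro t ht
      have : t / dist u.1 v.1 ∈ Icc (0 : ℝ) 1 :=
        ⟨div_nonneg ht.1 dist_nonneg, div_le_one_of_le₀ ht.2 dist_nonneg⟩
      rw [hγ]
      exact (convex_ball x.1 R).lineMap_mem (Metric.mem_ball.2 hu) (Metric.mem_ball.2 hv) this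
    have hγ0 : γ 0 = u := Subtype.ext (by rw [hγ, zero_div, AffineMap.lineMap_apply_zero])
    have hγ1 : γ (dist u.1 v.1) = v := by
      refine Subtype.ext ?_
      rw [hγ]
      obtain h | h := eq_or_ne (dist u.1 v.1) 0
      · rw [dist_eq_zero.1 h, AffineMap.lineMap_same_apply]
      · rw [div_self h, AffineMap.lineMap_apply_one]
    refine ⟨fun t => shape (γ t), ?_⟩
    unfold IsGeodesicIn IsGeodesic
    rw [huv]
    refine ⟨⟨congrArg shape hγ0, congrArg shape hγ1, fun t ht t' ht' => ?_⟩, fun t ht => ?_⟩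
    · rw [(hdist _ _ (hnear t ht) (hnear t' ht')).2, hγ, hγ, dist_lineMap_lineMap, Real.dist_eq,
        ← sub_div, abs_div, abs_of_nonneg dist_nonneg]
      obtain h | h := (dist_nonneg (x := u.1) (y := v.1)).eq_or_lt
      · rw [← h] at ht ht' ⊢
        rw [le_antisymm ht.2 ht.1, le_antisymm ht'.2 ht'.1]
        simp
      · field_simp
    · rw [Metric.mem_ball, (hdist _ _ (hnear t ht) hxR).2]
      exact hnear t ht
  · intro a ha b hb c hc γ hγ t ht
    obtain ⟨g, hg, hgR⟩ := hball _ (hγ.2 t ht)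
    have h0 := hγ.1.2.2 0 ⟨le_rfl, dist_nonneg⟩ t ht
    have h1 := hγ.1.2.2 t ht _ ⟨dist_nonneg, le_rfl⟩
    rw [hγ.1.1, zero_sub, abs_neg, abs_of_nonneg ht.1] at h0
    rw [hγ.1.2.1, abs_sub_comm, abs_of_nonneg (sub_nonneg.2 ht.2)] at h1
    obtain ⟨u, rfl, hu⟩ := hball a ha
    obtain ⟨v, rfl, hv⟩ := hball b hb
    obtain ⟨w, rfl, hw⟩ := hball c hc
    rw [← hg] at h0 h1 ⊢
    rw [(hdist v w hv hw).2] at *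
    rw [(hdist v g hv hgR).2] at h0
    rw [(hdist g w hgR hw).2] at h1
    rw [(hdist u g hu hgR).2, (hdist u v hu hv).2, (hdist u w hu hw).2]
    exact (stewart_inner h0 h1 rfl).le

theorem genericallyNonPositivelyCurved [Nontrivial A] :
    GenericallyNonPositivelyCurved (RestrictedShapeSpace F A 2) := by
  refine ⟨{a | CurvatureAtMost 0 a}, isOpen_curvatureAtMost_zero, ?_, fun a ha => ?_,
    fun a ha κ hκ => ha (curvatureAtMost_zero_of_curvatureAtMost hκ)⟩
  · rw [dense_iff_inter_open]
    rintro U hU ⟨a, ha⟩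
    obtain ⟨x, rfl⟩ := exists_shape a
    obtain ⟨y, hy, hyU, -⟩ := exists_isMaximal hU ha
    exact ⟨shape y, hyU, hy.curvatureAtMost_zero⟩
  · exact ⟨_, isOpen_curvatureAtMost_zero.mem_nhds ha, fun _ h => h⟩

end QED

/-! ### The TED metric -/

section TED

variable {T : BinaryTree} {F : TopologyFamily T} {A : Type} [NormedAddCommGroup A]
  [NormedSpace ℝ A] [Nontrivial A]

theorem GeodesicsNotLocallyUnique.of_dense {Y : Type*} [MetricSpace Y] {x : Y}
    (h : ∀ U, IsOpen U → x ∈ U → ∃ y ∈ U, GeodesicsNotLocallyUnique y) :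
    GeodesicsNotLocallyUnique x := by
  intro U hU
  obtain ⟨V, hVU, hV, hxV⟩ := mem_nhds_iff.1 hU
  obtain ⟨y, hyV, hy⟩ := h V hV hxV
  exact hy U (mem_of_superset (hV.mem_nhds hyV) hVU)

/-- `min t s` and `max (t - s) 0` are the coordinates of a path that runs along one side of a square
and then along the next. Both are monotone in `t`, so the path has unit ℓ¹ speed. -/
theorem abs_min_sub_add_abs_max_sub (s t t' : ℝ) :
    |min t s - min t' s| + |max (t - s) 0 - max (t' - s) 0| = |t - t'| := by
  rcases le_total t s with h | h <;> rcases le_total t' s with h' | h' <;>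
    simp only [min_eq_left, min_eq_right, max_eq_left, max_eq_right, h, h', sub_nonneg, sub_nonpos,
      sub_self, abs_zero, add_zero, zero_add, sub_sub_sub_cancel_right]
  · rw [abs_of_nonpos, abs_of_nonpos, abs_of_nonpos] <;> linarith
  · rw [abs_of_nonneg, abs_of_nonneg, abs_of_nonneg] <;> linarith

/-- Changing the attributes of two nonzero edges in a fixed unit direction `v` spans a flat ℓ¹
square in the chart; the two ways around it have equal length. -/
theorem IsMaximal.geodesicsNotLocallyUnique {x : restrictedPreShapes F A 1} (hx : IsMaximal F x.1)
    (hcard : 2 ≤ (supp x.1).ncard) : GeodesicsNotLocallyUnique (shape x) := by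
  classical
  intro U hU
  obtain ⟨R, hR, -, hdist⟩ := hx.exists_chart
  obtain ⟨ε, hε, hεU⟩ := Metric.mem_nhds_iff.1 hU
  obtain ⟨e, he, f, hf, hef⟩ := (one_lt_ncard (toFinite _)).1 hcard
  obtain ⟨v, hv⟩ := exists_norm_eq A zero_le_one
  obtain ⟨s, hs, hsR, hsε⟩ : ∃ s > 0, 2 * s < R ∧ 2 * s < ε :=
    ⟨min R ε / 3, by positivity, by linarith [min_le_left R ε, lt_min hR hε],
      by linarith [min_le_right R ε, lt_min hR hε]⟩
  let q : ℝ → ℝ → PreShape T A 1 := fun α β =>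
    x.1 + (PiLp.single 1 e (α • v) + PiLp.single 1 f (β • v))
  have hq : ∀ α β α' β', dist (q α β) (q α' β') = |α - α'| + |β - β'| := by
    intro α β α' β'
    have : q α β - q α' β' =
        PiLp.single 1 e ((α - α') • v) + PiLp.single 1 f ((β - β') • v) := by
      refine PiLp.ext fun i => ?_
      simp only [q, PiLp.sub_apply, PiLp.add_apply, PiLp.single_apply]
      split_ifs <;> simp [sub_smul]; abel
    rw [dist_eq_norm, this, PiLp.norm_eq_of_L1]
    have h1 : ∀ i, ‖(PiLp.single 1 e ((α - α') • v) + PiLp.single 1 f ((β - β') • v) :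
        PreShape T A 1) i‖ = (if i = e then |α - α'| else 0) + if i = f then |β - β'| else 0 := by
      intro i
      rw [PiLp.add_apply, PiLp.single_apply, PiLp.single_apply]
      by_cases hie : i = e
      · have : i ≠ f := fun h => hef (hie.symm.trans h)
        simp [hie, hef, norm_smul, hv]
      · by_cases hif : i = f <;> simp [hie, hif, Ne.symm hef, norm_smul, hv]
    simp only [h1, Finset.sum_add_distrib, Finset.sum_ite_eq', Finset.mem_univ, if_true]
  have hqx : x.1 = q 0 0 := by
    refine PiLp.ext fun i => ?_
    simp [q, PiLp.single_apply]
  have hqZ : ∀ α β, q α β ∈ restrictedPreShapes F A 1 := by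
    intro α β
    refine mem_restrictedPreShapes_of_supp_subset x.2 fun i hi => ?_
    by_contra hix
    have hie : i ≠ e := fun h => hix (h ▸ he)
    have hif : i ≠ f := fun h => hix (h ▸ hf)
    have hx0 : x.1 i = 0 := by simpa [mem_supp] using hix
    refine hi ?_
    simp [q, hie, hif, hx0]
  have hnear : ∀ α β, |α| + |β| ≤ 2 * s → dist (q α β) x.1 < R := by
    intro α β h
    rw [hqx, hq, sub_zero, sub_zero]
    linarith
  have hd : ∀ α β α' β', |α| + |β| ≤ 2 * s → |α'| + |β'| ≤ 2 * s →
      dist (shape (⟨q α β, hqZ α β⟩ : restrictedPreShapes F A 1)) (shape ⟨q α' β', hqZ α' β'⟩) =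
        |α - α'| + |β - β'| := by
    intro α β α' β' h h'
    rw [(hdist ⟨_, hqZ _ _⟩ ⟨_, hqZ _ _⟩ (hnear α β h) (hnear α' β' h')).2, hq]
  have hin : ∀ α β, |α| + |β| ≤ 2 * s →
      shape (⟨q α β, hqZ α β⟩ : restrictedPreShapes F A 1) ∈ U := by
    intro α β h
    refine hεU ?_
    have hx0 : x = ⟨q 0 0, hqZ 0 0⟩ := Subtype.ext hqx
    rw [Metric.mem_ball, hx0, hd _ _ _ _ h (by simpa using hs.le), sub_zero, sub_zero]
    linarith
  have h00 : |(0 : ℝ)| + |(0 : ℝ)| ≤ 2 * s := by simpa using hs.le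
  have hss : |s| + |s| ≤ 2 * s := by rw [abs_of_pos hs]; linarith
  have hab : dist (shape (⟨q 0 0, hqZ 0 0⟩ : restrictedPreShapes F A 1))
      (shape ⟨q s s, hqZ s s⟩) = 2 * s := by
    rw [hd _ _ _ _ h00 hss, zero_sub, abs_neg, abs_of_pos hs]
    ring
  have hm : ∀ t ∈ Icc 0 (2 * s), |min t s| + |max (t - s) 0| ≤ 2 * s := by
    intro t ht
    have := abs_min_sub_add_abs_max_sub s t 0
    rw [min_eq_left hs.le, max_eq_right (by linarith : (0 : ℝ) - s ≤ 0), sub_zero, sub_zero,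
      sub_zero, abs_of_nonneg ht.1] at this
    linarith [ht.2]
  have hm' : ∀ t ∈ Icc 0 (2 * s), |max (t - s) 0| + |min t s| ≤ 2 * s := fun t ht => by
    rw [add_comm]
    exact hm t ht
  refine ⟨_, hin 0 0 h00, _, hin s s hss,
    fun t => shape ⟨q (min t s) (max (t - s) 0), hqZ _ _⟩,
    fun t => shape ⟨q (max (t - s) 0) (min t s), hqZ _ _⟩, ?_, ?_, ?_⟩
  · unfold IsGeodesicIn IsGeodesic
    rw [hab]
    refine ⟨⟨?_, ?_, fun t ht t' ht' => ?_⟩, fun t ht => hin _ _ (hm t ht)⟩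
    · simp [hs.le]
    · simp [two_mul, hs.le]
    · rw [hd _ _ _ _ (hm t ht) (hm t' ht'), abs_min_sub_add_abs_max_sub]
  · unfold IsGeodesicIn IsGeodesic
    rw [hab]
    refine ⟨⟨?_, ?_, fun t ht t' ht' => ?_⟩, fun t ht => hin _ _ (hm' t ht)⟩
    · simp [hs.le]
    · simp [two_mul, hs.le]
    · rw [hd _ _ _ _ (hm' t ht) (hm' t' ht'), add_comm, abs_min_sub_add_abs_max_sub]
  · have hmem : s ∈ Icc 0 (2 * s) := ⟨hs.le, by linarith⟩
    refine ⟨s, by rwa [hab], fun h => ?_⟩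
    have := hd _ _ _ _ (hm s hmem) (hm' s hmem)
    rw [dist_eq_zero.2 h] at this
    simp only [min_self, sub_self, max_self, sub_zero, zero_sub, abs_neg, abs_of_pos hs] at this
    linarith

/-- The hypothesis gives a representative inside the coordinate subspace of a topology with two
edges. A perturbation makes all those edges nonzero, and passing to a nearby maximal shape does not
lower their number. -/
theorem geodesicsNotLocallyUnique (hF : ∀ S ∈ F.carrier, ∃ S' S₁ : Set T.Edge,
    SameTopology S S' ∧ S' ⊆ S₁ ∧ S₁ ∈ F.carrier ∧ 2 ≤ S₁.ncard) (a : RestrictedShapeSpace F A 1) :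
    GeodesicsNotLocallyUnique a := by
  refine GeodesicsNotLocallyUnique.of_dense fun U hU ha => ?_
  obtain ⟨x, rfl⟩ := exists_shape a
  obtain ⟨S, hS, hxS⟩ := mem_restrictedPreShapes.1 x.2
  obtain ⟨S', S₁, ⟨φ, hφ⟩, hS'₁, hS₁, hcard⟩ := hF S hS
  obtain ⟨τ, -, hτ⟩ := hφ.exists_isometry (A := A) (p := 1)
  obtain ⟨hxy, hy⟩ := hτ x.1 hxS
  obtain ⟨ε, hε, hball⟩ := Metric.isOpen_iff.1 hU _ ha
  obtain ⟨z, hz, hd⟩ := exists_supp_eq (τ x.1) (hy.trans hS'₁) hε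
  let y : restrictedPreShapes F A 1 :=
    ⟨τ x.1, mem_restrictedPreShapes.2 ⟨S₁, hS₁, hy.trans hS'₁⟩⟩
  let w : restrictedPreShapes F A 1 := ⟨z, mem_restrictedPreShapes.2 ⟨S₁, hS₁, hz.subset⟩⟩
  have hxy' : shape x = shape y := shape_eq_iff.2 hxy
  have hw : shape w ∈ U := hball <| by
    rw [Metric.mem_ball', hxy']
    exact (dist_shape_le (x := y) (y := w) (segment_subset_of_supp_subset hS₁ (hy.trans hS'₁)
      hz.subset)).trans_lt hd
  obtain ⟨u, hu, huU, hle⟩ := exists_isMaximal hU hw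
  refine ⟨shape u, huU, hu.geodesicsNotLocallyUnique (le_trans ?_ hle)⟩
  change 2 ≤ (supp z).ncard
  rwa [hz]

end TED

end TreeShape

/-- Curvature of the spaces of ordered tree-shapes with the QED metric (exponent `2`) and the TED
metric (exponent `1`). -/
theorem mainTheorem2 (T : TreeShape.BinaryTree) (hT : 2 ≤ T.edges.card) (d n : ℕ) (hd : 1 ≤ d)
    (hn : 1 ≤ n) :
    (TreeShape.GenericallyNonPositivelyCurved
        (TreeShape.ShapeSpace T (TreeShape.Attr d n) 2) ∧
      ∀ x : TreeShape.ShapeSpace T (TreeShape.Attr d n) 1,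
        TreeShape.GeodesicsNotLocallyUnique x ∧ TreeShape.CurvatureInfinite x) ∧
    ∀ F : TreeShape.TopologyFamily T,
      TreeShape.GenericallyNonPositivelyCurved
        (TreeShape.RestrictedShapeSpace F (TreeShape.Attr d n) 2) ∧
      ((∀ S ∈ F.carrier, ∃ S' S₁ : Set T.Edge,
          TreeShape.SameTopology S S' ∧ S' ⊆ S₁ ∧ S₁ ∈ F.carrier ∧ 2 ≤ S₁.ncard) →
        ∀ x : TreeShape.RestrictedShapeSpace F (TreeShape.Attr d n) 1,
          TreeShape.GeodesicsNotLocallyUnique x ∧ TreeShape.CurvatureInfinite x) := by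
  have : Nonempty (Fin d) := ⟨⟨0, hd⟩⟩
  have : Nonempty (Fin n) := ⟨⟨0, hn⟩⟩
  have hA : Nontrivial (TreeShape.Attr d n) := inferInstance
  have h : ∀ F : TreeShape.TopologyFamily T, (∀ S ∈ F.carrier, ∃ S' S₁ : Set T.Edge,
      TreeShape.SameTopology S S' ∧ S' ⊆ S₁ ∧ S₁ ∈ F.carrier ∧ 2 ≤ S₁.ncard) →
      ∀ x : TreeShape.RestrictedShapeSpace F (TreeShape.Attr d n) 1,
        TreeShape.GeodesicsNotLocallyUnique x ∧ TreeShape.CurvatureInfinite x := by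
    intro F hF x
    have := TreeShape.geodesicsNotLocallyUnique hF x
    exact ⟨this, this.curvatureInfinite⟩
  refine ⟨⟨TreeShape.genericallyNonPositivelyCurved, h _ fun S _ => ?_⟩,
    fun F => ⟨TreeShape.genericallyNonPositivelyCurved, h F⟩⟩
  refine ⟨S, univ, ⟨Equiv.refl _, fun _ _ => ⟨Iff.rfl, Iff.rfl⟩⟩, subset_univ _, mem_univ _, ?_⟩
  rw [ncard_univ, Nat.card_eq_fintype_card]
  simpa using hT
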